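/- Let $\mathbb T$ be the set of finite words over $\{1,2\}$, viewed as the binary tree with root $\varnothing$, in which $\mathbf i\neq\varnothing$ has as its parent the word obtained by deleting its last letter. Let $\Omega=(\omega_{\mathbf i})_{\mathbf i\in\mathbb T}$ with $\omega_{\mathbf i}=(\tau_{\mathbf i},\kappa_{\mathbf i})$ be i.i.d. uniformly distributed on $[0,1]\times\{1,2\}$. For $A\subset\mathbb T$, write $\mathbf i\xrightarrow{A}\infty$ if there are $(j_k)_{k\ge1}$ in $\{1,2\}$ with $j_{k+1}\le\kappa_{\mathbf i j_1\cdots j_k}$ and $\mathbf i j_1\cdots j_k\in A$ for all $k\ge 0$. Put $\mathbb T^t:=\{\mathbf i:\kappa_{\mathbf i}=1,\ \tau_{\mathbf i}\le t\}\cup\{\mathbf i:\kappa_{\mathbf i}=2\}$. Let $\Xi\subset(0,1]$ be relatively closed in $(0,1]$. A random set $\mathbb F\subset\mathbb T$, defined on the same probability space as $\Omega$, solves the frozen percolation equation relative to $\Omega$ if almost surely, for all $\mathbf i\in\mathbb T$, $$\mathbf i\in\mathbb F\iff \kappa_{\mathbf i}=1\text{ and }\mathbf i1\xrightarrow{\mathbb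 T^t\setminus\mathbb F}\infty\text{ for some }t\in\Xi\cap(0,\tau_{\mathbf i}].$$ Write $\Omega_{\mathbf j}:=(\omega_{\mathbf j\mathbf i})_{\mathbf i\in\mathbb T}$ and $\mathbb F_{\mathbf j}:=\{\mathbf i\in\mathbb T:\mathbf j\mathbf i\in\mathbb F\}$. A rooted subtree is a set $\mathbb U\subset\mathbb T$ that contains the parent of each of its elements other than $\varnothing$; its boundary $\partial\mathbb U$ is the set of words outside $\mathbb U$ whose parent lies in $\mathbb U$, with $\partial\mathbb U=\{\varnothing\}$ if $\mathbb U$ is empty. Call $\mathbb F$ stationary if the law of $(\Omega_{\mathbf j},\mathbb F_{\mathbf j})$ does not depend on $\mathbf j\in\mathbb T$; adapted if for each finite rooted subtree $\mathbb U$ the family $(\Omega_{\mathbf j},\mathbb F_{\mathbf j})_{\mathbf j\in\partial\mathbb U}$ is independent of $(\omega_{\mathbf i})_{\mathbf i\in\mathbb U}$; and say that $\mathbb F$ respects the tree structure if for each finite rooted subtree $\mathbb U$ the random variables $(\Omega_{\mathbf j},\mathbb F_{\mathbf j})$, $\mathbf j\in\partial\mathbb U$, are independent. Let $\mathbb F$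 be a solution relative to $\Omega$ that is stationary, adapted and respects the tree structure, and let $Y_{\mathbf i}:=\inf\{t\in\Xi:\mathbf i\xrightarrow{\mathbb T^t\setminus\mathbb F}\infty\}$ (with $\inf\emptyset:=\infty$) be its burning times. Then the following are equivalent: (i) The recursive tree process $(\omega_{\mathbf i},Y_{\mathbf i})_{\mathbf i\in\mathbb T}$ is endogenous, i.e. $Y_\varnothing$ is, up to a null set, measurable with respect to the $\sigma$-field generated by $\Omega$. (ii) Whenever, on any probability space, $\mathbb F'$ and $\mathbb F''$ are two solutions of the frozen percolation equation for $\Xi$ relative to the same i.i.d. family $\Omega'$ of uniformly distributed marks on $[0,1]\times\{1,2\}$, and both are stationary, adapted and respect the tree structure, then $\mathbb F'=\mathbb F''$ almost surely. -/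

import Mathlib

open MeasureTheory ProbabilityTheory

universe u v

namespace FrozenPercolation

/-- Finite words over the two-letter alphabet, written from the root upwards, so that `i ++ j` is
the concatenation `ij`, the root is `[]`, and the parent of `i ≠ []` is `i.dropLast`.
The element `0 : Fin 2` stands for the letter `1`, the element `1 : Fin 2` for the letter `2`. -/
abbrev Word : Type := List (Fin 2)

/-- A mark `ω = (τ, κ)`: an activation time `τ ∈ [0,1]` and a number of legal offspring
`κ ∈ {1,2}`, where `0 : Fin 2` stands for `κ = 1` and `1 : Fin 2` for `κ = 2`
(the same shift as for letters, so that `j ≤ κ` keeps its meaning). -/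
abbrev Mark : Type := unitInterval × Fin 2

/-- The uniform distribution on `[0,1] × {1,2}`. -/
noncomputable def markLaw : Measure Mark :=
  (volume : Measure unitInterval).prod (uniformOn (Set.univ : Set (Fin 2)))

/-- Percolation `i → ∞` through `A`: there are letters `j₁, j₂, …` (here `j k` is `j_{k+1}`) such
that for all `k ≥ 0` one has `j_{k+1} ≤ κ_{i j₁ ⋯ j_k}` and `i j₁ ⋯ j_k ∈ A`. -/
def Percolates (w : Word → Mark) (A : Set Word) (i : Word) : Prop :=
  ∃ j : ℕ → Fin 2, ∀ k : ℕ,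
    j k ≤ (w (i ++ (List.range k).map j)).2 ∧ i ++ (List.range k).map j ∈ A

/-- The set `𝕋ᵗ` of all branching points, together with the internal points that have been
activated by time `t`. -/
def activeSet (w : Word → Mark) (t : ℝ) : Set Word :=
  {i | (w i).2 = 0 ∧ ((w i).1 : ℝ) ≤ t} ∪ {i | (w i).2 = 1}

/-- The (deterministic) set `F` satisfies the frozen percolation equation for the marks `w` and
the set `Ξ` of possible freezing times. -/
def FrozenEq (Ξ : Set ℝ) (w : Word → Mark) (F : Set Word) : Prop :=
  ∀ i : Word, i ∈ F ↔
    (w i).2 = 0 ∧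
      ∃ t ∈ Ξ ∩ Set.Ioc (0 : ℝ) ((w i).1 : ℝ), Percolates w (activeSet w t \ F) (i ++ [0])

/-- The burning time `Y_i = inf {t ∈ Ξ : i percolates through 𝕋ᵗ \ F}`, with values in
`[0,1] ∪ {∞}`, viewed as a subset of `[0,∞]`; the infimum of the empty set is `∞`. -/
noncomputable def burningTime (Ξ : Set ℝ) (w : Word → Mark) (F : Set Word) (i : Word) : ENNReal :=
  sInf (ENNReal.ofReal '' {t : ℝ | t ∈ Ξ ∧ Percolates w (activeSet w t \ F) i})

/-- `Ω_j = (ω_{ji})_i`. -/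
def shiftMarks (j : Word) (w : Word → Mark) : Word → Mark := fun i => w (j ++ i)

/-- `F_j = {i : ji ∈ F}`. -/
def shiftSet (j : Word) (F : Set Word) : Set Word := {i | j ++ i ∈ F}

/-- A finite set of words is a rooted subtree if it contains the parent of each of its elements
other than the root. -/
def IsRootedSubtree (U : Finset Word) : Prop := ∀ i ∈ U, i ≠ [] → i.dropLast ∈ U

/-- The boundary of a rooted subtree `U`: the words outside `U` whose parent lies in `U`. If `U`
is empty, this is `{[]}`; if `U` is not empty, then `[] ∈ U`, so `[]` is not in the boundary. -/
def treeBoundary (U : Finset Word) : Set Word := {i | i ∉ U ∧ (i = [] ∨ i.dropLast ∈ U)}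

section Random

variable {S : Type u} [MeasurableSpace S]

/-- `ω = (ω_i)` is an i.i.d. family, uniformly distributed on `[0,1] × {1,2}`. -/
structure IsMarkField (P : Measure S) (ω : S → Word → Mark) : Prop where
  measurable : Measurable ω
  law : ∀ i : Word, P.map (fun s => ω s i) = markLaw
  indep : iIndepFun (fun (i : Word) (s : S) => ω s i) P

/-- The pair `(Ω_j, F_j)` as a random variable. -/
def shiftPair (ω : S → Word → Mark) (F : S → Set Word) (j : Word) (s : S) :
    (Word → Mark) × Set Word :=
  (shiftMarks j (ω s), shiftSet j (F s))

/-- The random set `F` solves the frozen percolation equation almost surely. -/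
structure IsFrozenSolution (Ξ : Set ℝ) (P : Measure S) (ω : S → Word → Mark)
    (F : S → Set Word) : Prop where
  measurable : Measurable F
  solves : ∀ᵐ s ∂P, FrozenEq Ξ (ω s) (F s)

/-- The law of `(Ω_j, F_j)` does not depend on `j`. -/
def IsStationary (P : Measure S) (ω : S → Word → Mark) (F : S → Set Word) : Prop :=
  ∀ j j' : Word, P.map (shiftPair ω F j) = P.map (shiftPair ω F j')

/-- For each finite rooted subtree `U`, the family `(Ω_j, F_j)_{j ∈ ∂U}` is independent of the
family `(ω_i)_{i ∈ U}`. -/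
def IsAdapted (P : Measure S) (ω : S → Word → Mark) (F : S → Set Word) : Prop :=
  ∀ U : Finset Word, IsRootedSubtree U →
    IndepFun (fun (s : S) (j : treeBoundary U) => shiftPair ω F j s)
      (fun (s : S) (i : U) => ω s i) P

/-- For each finite rooted subtree `U`, the random variables `(Ω_j, F_j)`, `j ∈ ∂U`, are
independent. -/
def RespectsTree (P : Measure S) (ω : S → Word → Mark) (F : S → Set Word) : Prop :=
  ∀ U : Finset Word, IsRootedSubtree U →
    iIndepFun (fun (j : treeBoundary U) (s : S) => shiftPair ω F j s) P

/-- Endogeny of the process `(ω_i, Y_i)` of burning times: `Y_∅` is (up to a null set) measurable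
with respect to the σ-field generated by `Ω`. -/
def IsEndogenous (Ξ : Set ℝ) (P : Measure S) (ω : S → Word → Mark) (F : S → Set Word) : Prop :=
  ∃ Y : S → ENNReal, Measurable[MeasurableSpace.comap ω inferInstance] Y ∧
    (fun s => burningTime Ξ (ω s) (F s) []) =ᵐ[P] Y

end Random

end FrozenPercolation

namespace FrozenPercolation

/-! ### Percolation and burning times for fixed marks -/

section Deterministic

variable {Ξ : Set ℝ} {w : Word → Mark} {A B F : Set Word} {i : Word} {t t' : ℝ}

/-! (i) ⇒ (ii) rests on the fact that the joint law of `Ω` and `Y_∅` is the same for all solutions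
of the given kind. If `Y_∅ = g(Ω)` for one of them, then this holds for all
(`IsRecursiveLaw.ae_rootTime_eq`). By stationarity `Y_j = g(Ω_j)` at every word `j`, and the frozen
percolation equation recovers `F` from marks and burning times (`frozenEq_iff`).

The joint law is determined, by induction on the depth of the marks retained, by the law `μ` of
`Y_∅`. For `μ` itself, the recursion at the root gives `μ[0,t]² = ∫_{[0,t]} s dμ(s)`
(`IsRecursiveLaw.sq_burningLaw_eq_lintegral`). This alone does not suffice, since `δ_∞` also
satisfies it. The second input is `t ≤ 2 μ[0,t]` for `t ∈ Ξ` (`IsRecursiveLaw.half_le`), read off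
from the probabilities of surviving `n` generations. Together they give `t ≤ μ[0,t] + μ[0,t)` on `Ξ`
(`IsRecursiveLaw.le_add`). For two such laws `μ`, `ν`, integrating each inequality against the other
law and then by parts yields `μ[0,t]² + ν[0,t]² ≤ 2 μ[0,t] ν[0,t]`, hence `μ = ν`
(`IsRecursiveLaw.burningLaw_eq`).

(ii) ⇒ (i): draw two copies of `F` that are conditionally independent given `Ω`. Being a solution of
the given kind depends only on the law of `(Ω, F)` (`isTreeSolution_map_iff`), so both copies are
such solutions and (ii) makes them equal. A conditional law whose independent samples agree is
degenerate (`exists_measurable_of_condIndep_eq`), so `F`, and with it `Y_∅`, is a function of `Ω`.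
-/

lemma exists_forall_of_antitone {ι : Type*} [LinearOrder ι] {p : ι → Fin 2 → Prop}
    (hp : ∀ j, Antitone fun n => p n j) (h : ∀ n, ∃ j, p n j) : ∃ j, ∀ n, p n j := by
  by_contra! hc
  obtain ⟨n₀, h₀⟩ := hc 0
  obtain ⟨n₁, h₁⟩ := hc 1
  obtain ⟨j, hj⟩ := h (max n₀ n₁)
  fin_cases j
  · exact h₀ (hp 0 (le_max_left _ _) hj)
  · exact h₁ (hp 1 (le_max_right _ _) hj)

/-- There is an open path through `A` that starts in `i` and passes through `n` vertices. -/
def PercolatesUpTo (w : Word → Mark) (A : Set Word) : ℕ → Word → Prop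
  | 0, _ => True
  | n + 1, i => i ∈ A ∧ ∃ j : Fin 2, j ≤ (w i).2 ∧ PercolatesUpTo w A n (i ++ [j])

lemma PercolatesUpTo.mono (h : A ⊆ B) {n : ℕ} :
    ∀ {i}, PercolatesUpTo w A n i → PercolatesUpTo w B n i := by
  induction n with
  | zero => intro i _; trivial
  | succ n ih =>
    rintro i ⟨hi, j, hj, hp⟩
    exact ⟨h hi, j, hj, ih hp⟩

lemma PercolatesUpTo.of_succ {n : ℕ} :
    ∀ {i}, PercolatesUpTo w A (n + 1) i → PercolatesUpTo w A n i := by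
  induction n with
  | zero => intro i _; trivial
  | succ n ih =>
    rintro i ⟨hi, j, hj, hp⟩
    exact ⟨hi, j, hj, ih hp⟩

lemma antitone_percolatesUpTo (w : Word → Mark) (A : Set Word) (i : Word) :
    Antitone fun n => PercolatesUpTo w A n i :=
  antitone_nat_of_succ_le fun _ h => h.of_succ

/-- Choosing successors inside `G` over and over builds the infinite path. `G` serves as a
coinductive invariant. -/
lemma percolates_of_forall_step (G : Set Word)
    (hG : ∀ i ∈ G, i ∈ A ∧ ∃ j : Fin 2, j ≤ (w i).2 ∧ i ++ [j] ∈ G) (hi : i ∈ G) :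
    Percolates w A i := by
  have : ∀ i, ∃ j : Fin 2, i ∈ G → j ≤ (w i).2 ∧ i ++ [j] ∈ G := by
    intro i
    by_cases h : i ∈ G
    · obtain ⟨-, j, hj⟩ := hG i h
      exact ⟨j, fun _ => hj⟩
    · exact ⟨0, fun h' => absurd h' h⟩
  choose f hf using this
  let x : ℕ → Word := fun n => Nat.rec i (fun _ v => v ++ [f v]) n
  have hx : ∀ k, x k = i ++ (List.range k).map fun k => f (x k) := by
    intro k
    induction k with
    | zero => simp [x]
    | succ k ih =>
      rw [List.range_succ, List.map_append, ← List.append_assoc, ← ih]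
      rfl
  have hxG : ∀ k, x k ∈ G := by
    intro k
    induction k with
    | zero => exact hi
    | succ k ih => exact (hf _ ih).2
  refine ⟨fun k => f (x k), fun k => ?_⟩
  rw [← hx]
  exact ⟨(hf _ (hxG k)).1, (hG _ (hxG k)).1⟩

lemma Percolates.step (h : Percolates w A i) :
    i ∈ A ∧ ∃ j : Fin 2, j ≤ (w i).2 ∧ Percolates w A (i ++ [j]) := by
  obtain ⟨j, hj⟩ := h
  have h0 := hj 0
  simp only [List.range_zero, List.map_nil, List.append_nil] at h0
  refine ⟨h0.2, j 0, h0.1, fun k => j (k + 1), fun k => ?_⟩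
  have := hj (k + 1)
  rw [List.range_succ_eq_map, List.map_cons, List.map_map] at this
  simpa [Function.comp_def] using this

lemma percolates_iff_step :
    Percolates w A i ↔ i ∈ A ∧ ∃ j : Fin 2, j ≤ (w i).2 ∧ Percolates w A (i ++ [j]) := by
  refine ⟨Percolates.step, fun h => ?_⟩
  refine percolates_of_forall_step
    {i | i ∈ A ∧ ∃ j : Fin 2, j ≤ (w i).2 ∧ Percolates w A (i ++ [j])} ?_ h
  rintro i ⟨hi, j, hj, hp⟩
  exact ⟨hi, j, hj, hp.step⟩

/-- König's lemma. -/
lemma percolates_iff_forall : Percolates w A i ↔ ∀ n, PercolatesUpTo w A n i := by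
  constructor
  · intro h n
    induction n generalizing i with
    | zero => trivial
    | succ n ih =>
      obtain ⟨hi, j, hj, hp⟩ := h.step
      exact ⟨hi, j, hj, ih hp⟩
  · refine percolates_of_forall_step {i | ∀ n, PercolatesUpTo w A n i} ?_
    intro i hi
    refine ⟨(hi 1).1, ?_⟩
    -- The sets of letters allowing `n` further steps are nonempty and decrease in `n`; as there are
    -- only two letters, one is good for all `n`.
    obtain ⟨j, hj⟩ := exists_forall_of_antitone
      (p := fun n j => j ≤ (w i).2 ∧ PercolatesUpTo w A n (i ++ [j]))
      (fun j m n hmn h => ⟨h.1, antitone_percolatesUpTo w A _ hmn h.2⟩) fun n => (hi (n + 1)).2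
    exact ⟨j, (hj 0).1, fun n => (hj n).2⟩

lemma Percolates.mono (h : A ⊆ B) (hp : Percolates w A i) : Percolates w B i :=
  percolates_iff_forall.2 fun n => (percolates_iff_forall.1 hp n).mono h

lemma activeSet_mono (w : Word → Mark) : Monotone (activeSet w) := by
  rintro s t hst i (⟨h0, hi⟩ | hi)
  · exact Or.inl ⟨h0, hi.trans hst⟩
  · exact Or.inr hi

lemma activeSet_diff_mono (w : Word → Mark) (F : Set Word) : Monotone fun t => activeSet w t \ F :=
  fun _ _ hst => Set.sdiff_subset_sdiff_left (activeSet_mono w hst)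

/-- Right-continuity in time: the condition `τ ≤ t` is closed, and one of the two letters serves all
`t' > t` simultaneously. The order is dualized because the requirement gets stronger as `t'`
decreases. -/
lemma percolatesUpTo_of_forall_gt {n : ℕ} :
    ∀ {i}, (∀ t' > t, PercolatesUpTo w (activeSet w t' \ F) n i) →
      PercolatesUpTo w (activeSet w t \ F) n i := by
  induction n with
  | zero => intro i _; trivial
  | succ n ih =>
    intro i h
    refine ⟨⟨?_, (h (t + 1) (by simp)).1.2⟩, ?_⟩
    · obtain hi | hi : (w i).2 = 0 ∨ (w i).2 = 1 := by omega
      · refine Or.inl ⟨hi, le_of_forall_gt_imp_ge_of_dense fun t' ht' => ?_⟩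
        rcases (h t' ht').1.1 with h' | h'
        · exact h'.2
        · exact absurd (hi.symm.trans h') (by simp)
      · exact Or.inr hi
    · obtain ⟨j, hj⟩ := exists_forall_of_antitone (ι := (Set.Ioi t)ᵒᵈ)
        (p := fun t' j => j ≤ (w i).2 ∧
          PercolatesUpTo w (activeSet w (OrderDual.ofDual t').1 \ F) n (i ++ [j]))
        (fun j r s hrs h => ⟨h.1, h.2.mono (activeSet_diff_mono w F hrs)⟩)
        (fun t' => (h (OrderDual.ofDual t').1 (OrderDual.ofDual t').2).2)
      exact ⟨j, (hj (OrderDual.toDual ⟨t + 1, by simp⟩)).1,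
        ih fun t' ht' => (hj (OrderDual.toDual ⟨t', ht'⟩)).2⟩

lemma percolates_of_forall_gt (h : ∀ t' > t, Percolates w (activeSet w t' \ F) i) :
    Percolates w (activeSet w t \ F) i :=
  percolates_iff_forall.2 fun n =>
    percolatesUpTo_of_forall_gt fun t' ht' => percolates_iff_forall.1 (h t' ht') n

/-- `Ξ` is a relatively closed subset of `(0,1]`. -/
def IsRelClosed (Ξ : Set ℝ) : Prop :=
  Ξ ⊆ Set.Ioc (0 : ℝ) 1 ∧ ∃ C : Set ℝ, IsClosed C ∧ Ξ = C ∩ Set.Ioc (0 : ℝ) 1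

lemma IsRelClosed.mem_of_forall_gt (hΞ : IsRelClosed Ξ) (ht : 0 < t)
    (h : ∀ t' > t, ∃ s ∈ Ξ, t ≤ s ∧ s < t') : t ∈ Ξ := by
  obtain ⟨hsub, C, hC, rfl⟩ := hΞ
  obtain ⟨u, hu, htu, -⟩ := h (t + 1) (by simp)
  refine ⟨?_, ht, htu.trans hu.2.2⟩
  rw [← hC.closure_eq, Metric.mem_closure_iff]
  intro ε hε
  obtain ⟨s, hs, hts, hst⟩ := h (t + ε) (by linarith)
  refine ⟨s, hs.1, ?_⟩
  rw [dist_comm, Real.dist_eq, abs_of_nonneg (by linarith)]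
  linarith

lemma exists_lt_of_burningTime_lt {c : ENNReal} (h : burningTime Ξ w F i < c) :
    ∃ s ∈ Ξ, Percolates w (activeSet w s \ F) i ∧ ENNReal.ofReal s < c := by
  obtain ⟨_, ⟨s, ⟨hs, hp⟩, rfl⟩, hsc⟩ := sInf_lt_iff.1 h
  exact ⟨s, hs, hp, hsc⟩

lemma burningTime_le (ht : t ∈ Ξ) (hp : Percolates w (activeSet w t \ F) i) :
    burningTime Ξ w F i ≤ ENNReal.ofReal t :=
  sInf_le ⟨t, ⟨ht, hp⟩, rfl⟩

/-- A positive infimum is attained, since `Ξ` is relatively closed and percolation is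
right-continuous in time. At `0` this may fail, because `Ξ` can accumulate there. -/
lemma burningTime_le_ofReal_iff (hΞ : IsRelClosed Ξ) (ht : 0 < t) :
    burningTime Ξ w F i ≤ ENNReal.ofReal t ↔
      ∃ s ∈ Ξ ∩ Set.Ioc (0 : ℝ) t, Percolates w (activeSet w s \ F) i := by
  constructor
  · intro h
    rcases h.lt_or_eq with h | h
    · obtain ⟨s, hs, hp, hst⟩ := exists_lt_of_burningTime_lt h
      exact ⟨s, ⟨hs, (hΞ.1 hs).1, ((ENNReal.ofReal_lt_ofReal_iff ht).1 hst).le⟩, hp⟩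
    · have key : ∀ t' > t, ∃ s ∈ Ξ, Percolates w (activeSet w s \ F) i ∧ t ≤ s ∧ s < t' := by
        intro t' ht'
        obtain ⟨s, hs, hp, hst⟩ := exists_lt_of_burningTime_lt (Ξ := Ξ) (w := w) (F := F) (i := i)
          (c := ENNReal.ofReal t') (by
            rw [h]
            exact (ENNReal.ofReal_lt_ofReal_iff (ht.trans ht')).2 ht')
        refine ⟨s, hs, hp, ?_, (ENNReal.ofReal_lt_ofReal_iff (ht.trans ht')).1 hst⟩
        rw [← ENNReal.ofReal_le_ofReal_iff (hΞ.1 hs).1.le, ← h]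
        exact burningTime_le hs hp
      refine ⟨t, ⟨hΞ.mem_of_forall_gt ht fun t' ht' => ?_, ht, le_rfl⟩,
        percolates_of_forall_gt fun t' ht' => ?_⟩
      · obtain ⟨s, hs, -, h1, h2⟩ := key t' ht'
        exact ⟨s, hs, h1, h2⟩
      · obtain ⟨s, hs, hp, h1, h2⟩ := key t' ht'
        exact hp.mono (activeSet_diff_mono w F h2.le)
  · rintro ⟨s, ⟨hs, -, hst⟩, hp⟩
    exact (burningTime_le hs hp).trans (ENNReal.ofReal_le_ofReal hst)

lemma burningTime_le_ofReal_iff_percolates (hΞ : IsRelClosed Ξ) (ht : t ∈ Ξ) :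
    burningTime Ξ w F i ≤ ENNReal.ofReal t ↔ Percolates w (activeSet w t \ F) i := by
  rw [burningTime_le_ofReal_iff hΞ (hΞ.1 ht).1]
  constructor
  · rintro ⟨s, ⟨-, -, hst⟩, hp⟩
    exact hp.mono (activeSet_diff_mono w F hst)
  · exact fun hp => ⟨t, ⟨ht, (hΞ.1 ht).1, le_rfl⟩, hp⟩

lemma burningTime_eq_top_or (hΞ : IsRelClosed Ξ) :
    burningTime Ξ w F i = ⊤ ∨ burningTime Ξ w F i ≤ 1 := by
  by_cases h : burningTime Ξ w F i = ⊤
  · exact Or.inl h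
  · obtain ⟨s, hs, hp, -⟩ := exists_lt_of_burningTime_lt (lt_top_iff_ne_top.2 h)
    refine Or.inr ((burningTime_le hs hp).trans ?_)
    rw [← ENNReal.ofReal_one]
    exact ENNReal.ofReal_le_ofReal (hΞ.1 hs).2

lemma mem_of_burningTime_eq (hΞ : IsRelClosed Ξ) (ht : 0 < t)
    (h : burningTime Ξ w F i = ENNReal.ofReal t) : t ∈ Ξ := by
  obtain ⟨s, ⟨hs, -, hst⟩, hp⟩ := (burningTime_le_ofReal_iff hΞ ht).1 h.le
  have := h.symm.le.trans (burningTime_le hs hp)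
  rw [ENNReal.ofReal_le_ofReal_iff (hΞ.1 hs).1.le] at this
  rwa [le_antisymm this hst]

/-- `F` is a function of marks and burning times. The clause `0 < τ` covers `τ = 0`, where `Ξ ∩ (0,
τ]` is empty although the child may have burning time `0`. -/
lemma frozenEq_iff (hΞ : IsRelClosed Ξ) :
    FrozenEq Ξ w F ↔ ∀ i, i ∈ F ↔ (w i).2 = 0 ∧ 0 < ((w i).1 : ℝ) ∧
      burningTime Ξ w F (i ++ [0]) ≤ ENNReal.ofReal (w i).1 := by
  refine forall_congr' fun i => iff_congr Iff.rfl (and_congr_right fun _ => ?_)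
  by_cases h : 0 < ((w i).1 : ℝ)
  · simp only [h, true_and]
    rw [burningTime_le_ofReal_iff hΞ h]
  · simp only [h, false_and, iff_false]
    rintro ⟨t, ⟨-, h1, h2⟩, -⟩
    exact h (h1.trans_le h2)

/-- The burning time of a vertex with mark `m` whose children have burning times `a` and `b`. -/
noncomputable def burningMap (m : Mark) (a b : ENNReal) : ENNReal :=
  if m.2 = 0 then (if a ≤ ENNReal.ofReal m.1 then ⊤ else a) else min a b

lemma percolates_of_branching (hF : FrozenEq Ξ w F) (h : (w i).2 = 1) :
    Percolates w (activeSet w t \ F) i ↔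
      Percolates w (activeSet w t \ F) (i ++ [0]) ∨
        Percolates w (activeSet w t \ F) (i ++ [1]) := by
  have hi : i ∈ activeSet w t \ F := ⟨Or.inr h, fun hi => by
    have := ((hF i).1 hi).1
    rw [h] at this
    simp at this⟩
  rw [percolates_iff_step, Fin.exists_fin_two, h]
  simp [hi]

lemma percolates_of_internal (h : (w i).2 = 0) :
    Percolates w (activeSet w t \ F) i ↔
      ((w i).1 : ℝ) ≤ t ∧ i ∉ F ∧ Percolates w (activeSet w t \ F) (i ++ [0]) := by
  rw [percolates_iff_step, Fin.exists_fin_two, h]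
  simp [activeSet, h, and_assoc]

/-- Positivity of `τ` cannot be dropped: with `τ = 0` and a child burning at time `0`, the vertex is
not frozen, yet `burningMap` returns `⊤`. Almost surely this does not occur. -/
lemma burningTime_eq_burningMap (hΞ : IsRelClosed Ξ) (hF : FrozenEq Ξ w F)
    (hi : 0 < ((w i).1 : ℝ)) :
    burningTime Ξ w F i =
      burningMap (w i) (burningTime Ξ w F (i ++ [0])) (burningTime Ξ w F (i ++ [1])) := by
  unfold burningMap
  have hmem := (frozenEq_iff hΞ).1 hF i
  split_ifs with h0 hle
  · have : i ∈ F := hmem.2 ⟨h0, hi, hle⟩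
    rw [burningTime, sInf_eq_top]
    rintro _ ⟨s, ⟨-, hp⟩, rfl⟩
    exact absurd this hp.step.1.2
  · have hiF : i ∉ F := fun h => hle (hmem.1 h).2.2
    have : {t : ℝ | t ∈ Ξ ∧ Percolates w (activeSet w t \ F) i} =
        {t : ℝ | t ∈ Ξ ∧ Percolates w (activeSet w t \ F) (i ++ [0])} := by
      ext t
      simp only [Set.mem_ofPred_eq, percolates_of_internal h0]
      refine and_congr_right fun ht => ⟨fun h => h.2.2, fun h => ⟨?_, hiF, h⟩⟩
      by_contra! hlt
      exact hle ((burningTime_le ht h).trans (ENNReal.ofReal_le_ofReal hlt.le))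
    rw [burningTime, this, burningTime]
  · have h1 : (w i).2 = 1 := by omega
    have : {t : ℝ | t ∈ Ξ ∧ Percolates w (activeSet w t \ F) i} =
        {t : ℝ | t ∈ Ξ ∧ Percolates w (activeSet w t \ F) (i ++ [0])} ∪
        {t : ℝ | t ∈ Ξ ∧ Percolates w (activeSet w t \ F) (i ++ [1])} := by
      ext t
      simp only [Set.mem_ofPred_eq, percolates_of_branching hF h1, Set.mem_union, and_or_left]
    rw [burningTime, this, Set.image_union, sInf_union]
    rfl

lemma preimage_activeSet_diff (j : Word) :
    {i | j ++ i ∈ activeSet w t \ F} = activeSet (shiftMarks j w) t \ shiftSet j F := rfl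

lemma percolates_append {j : Word} :
    Percolates w A (j ++ i) ↔ Percolates (shiftMarks j w) {i | j ++ i ∈ A} i := by
  simp [Percolates, shiftMarks]

lemma percolatesUpTo_append {j : Word} {n : ℕ} : ∀ {i},
    PercolatesUpTo w A n (j ++ i) ↔ PercolatesUpTo (shiftMarks j w) {i | j ++ i ∈ A} n i := by
  induction n with
  | zero => intro i; exact Iff.rfl
  | succ n ih =>
    intro i
    simp [PercolatesUpTo, shiftMarks, ← ih]

lemma burningTime_append (j i : Word) :
    burningTime Ξ w F (j ++ i) = burningTime Ξ (shiftMarks j w) (shiftSet j F) i := by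
  simp only [burningTime, percolates_append, preimage_activeSet_diff]

lemma burningTime_eq_shift (j : Word) :
    burningTime Ξ w F j = burningTime Ξ (shiftMarks j w) (shiftSet j F) [] := by
  rw [← burningTime_append, List.append_nil]

end Deterministic

/-! ### Measurability of burning times -/

section Measurability

variable {Ξ : Set ℝ}

/-- A realization of the marks together with a set of words. -/
abbrev Conf : Type := (Word → Mark) × Set Word

instance standardBorelSpace_setWord : StandardBorelSpace (Set Word) :=
  inferInstanceAs (StandardBorelSpace (Word → Prop))

instance isProbabilityMeasure_markLaw : IsProbabilityMeasure markLaw := by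
  unfold markLaw; infer_instance

/-- The burning time of the root. -/
noncomputable def rootTime (Ξ : Set ℝ) (x : Conf) : ENNReal := burningTime Ξ x.1 x.2 []

/-- The configuration seen from the vertex `j`. -/
def shiftConf (j : Word) (x : Conf) : Conf := (shiftMarks j x.1, shiftSet j x.2)

/-- The mark of the root together with the configurations seen from its two children. -/
def decompose (x : Conf) : Mark × Conf × Conf := (x.1 [], shiftConf [0] x, shiftConf [1] x)

lemma burningTime_eq_rootTime (x : Conf) (j : Word) :
    burningTime Ξ x.1 x.2 j = rootTime Ξ (shiftConf j x) :=
  burningTime_eq_shift j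

@[fun_prop]
lemma measurable_shiftMarks (j : Word) : Measurable (shiftMarks j) := by
  unfold shiftMarks; fun_prop

@[fun_prop]
lemma measurable_shiftSet (j : Word) : Measurable (shiftSet j) :=
  measurable_set_iff.2 fun i => measurable_set_mem (j ++ i)

@[fun_prop]
lemma measurable_shiftConf (j : Word) : Measurable (shiftConf j) := by
  unfold shiftConf; fun_prop

@[fun_prop]
lemma measurable_decompose : Measurable decompose := by
  unfold decompose; fun_prop

lemma measurable_mark_val (i : Word) : Measurable fun x : Conf => ((x.1 i).1 : ℝ) := by fun_prop

lemma measurable_mem_activeSet_diff (t : ℝ) (i : Word) :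
    Measurable fun x : Conf => i ∈ activeSet x.1 t \ x.2 := by
  have h1 : Measurable fun x : Conf => ((x.1 i).1 : ℝ) ≤ t :=
    measurableSet_setOfPred.1 (measurableSet_le (measurable_mark_val i) measurable_const)
  have h2 (k : Fin 2) : Measurable fun x : Conf => (x.1 i).2 = k := by fun_prop
  have h3 : Measurable fun x : Conf => i ∉ x.2 := (measurable_set_notMem i).comp measurable_snd
  exact (((h2 0).and h1).or (h2 1)).and h3

lemma measurable_percolatesUpTo (t : ℝ) (n : ℕ) : ∀ i : Word,
    Measurable fun x : Conf => PercolatesUpTo x.1 (activeSet x.1 t \ x.2) n i := by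
  induction n with
  | zero => intro i; exact measurable_const
  | succ n ih =>
    intro i
    refine (measurable_mem_activeSet_diff t i).and
      (Measurable.exists fun j => Measurable.and ?_ (ih _))
    exact measurableSet_setOfPred.1
      (measurableSet_le measurable_const (by fun_prop : Measurable fun x : Conf => (x.1 i).2))

lemma measurable_percolates (t : ℝ) (i : Word) :
    Measurable fun x : Conf => Percolates x.1 (activeSet x.1 t \ x.2) i := by
  simp only [percolates_iff_forall]
  exact Measurable.forall fun n => measurable_percolatesUpTo t n i

/-- By monotonicity in time, the possibly uncountable union over `Ξ ∩ (0, t]` reduces to its largest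
element, which makes the event measurable. -/
lemma burningTime_le_ofReal_iff_sSup (hΞ : IsRelClosed Ξ) {t : ℝ} (ht : 0 < t)
    (hne : (Ξ ∩ Set.Ioc 0 t).Nonempty) {w : Word → Mark} {F : Set Word} {i : Word} :
    burningTime Ξ w F i ≤ ENNReal.ofReal t ↔
      Percolates w (activeSet w (sSup (Ξ ∩ Set.Ioc 0 t)) \ F) i := by
  have hbdd : BddAbove (Ξ ∩ Set.Ioc 0 t) := ⟨t, fun s hs => hs.2.2⟩
  obtain ⟨s₀, hs₀⟩ := hne
  have hpos : 0 < sSup (Ξ ∩ Set.Ioc 0 t) := hs₀.2.1.trans_le (le_csSup hbdd hs₀)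
  have hle : sSup (Ξ ∩ Set.Ioc 0 t) ≤ t := csSup_le ⟨s₀, hs₀⟩ fun s hs => hs.2.2
  have hmem : sSup (Ξ ∩ Set.Ioc 0 t) ∈ Ξ := by
    obtain ⟨hsub, C, hC, hΞC⟩ := hΞ
    have : sSup (Ξ ∩ Set.Ioc 0 t) ∈ C :=
      closure_minimal (fun s hs => by rw [hΞC] at hs; exact hs.1.1) hC
        (csSup_mem_closure ⟨s₀, hs₀⟩ hbdd)
    rw [hΞC] at this ⊢
    refine ⟨by rwa [← hΞC] at this ⊢, ?_, ?_⟩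
    · rwa [← hΞC]
    · rw [← hΞC]
      exact csSup_le ⟨s₀, hs₀⟩ fun s hs => (hsub hs.1).2
  rw [burningTime_le_ofReal_iff hΞ ht]
  constructor
  · rintro ⟨s, hs, hp⟩
    exact hp.mono (activeSet_diff_mono w F (le_csSup hbdd hs))
  · exact fun hp => ⟨_, ⟨hmem, hpos, hle⟩, hp⟩

lemma measurableSet_burningTime_le (hΞ : IsRelClosed Ξ) {t : ℝ} (ht : 0 < t) (i : Word) :
    MeasurableSet {x : Conf | burningTime Ξ x.1 x.2 i ≤ ENNReal.ofReal t} := by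
  by_cases hne : (Ξ ∩ Set.Ioc 0 t).Nonempty
  · simp only [burningTime_le_ofReal_iff_sSup hΞ ht hne]
    exact (measurable_percolates _ i).setOf
  · rw [Set.not_nonempty_iff_eq_empty] at hne
    simp [burningTime_le_ofReal_iff hΞ ht, hne]

lemma measurable_burningTime (hΞ : IsRelClosed Ξ) (i : Word) :
    Measurable fun x : Conf => burningTime Ξ x.1 x.2 i := by
  refine measurable_of_Iio fun c => ?_
  have : (fun x : Conf => burningTime Ξ x.1 x.2 i) ⁻¹' Set.Iio c =
      ⋃ q : {q : ℚ // (0 : ℝ) < q ∧ ENNReal.ofReal q < c},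
        {x : Conf | burningTime Ξ x.1 x.2 i ≤ ENNReal.ofReal (q : ℚ)} := by
    ext x
    simp only [Set.mem_preimage, Set.mem_Iio, Set.mem_iUnion, Set.mem_ofPred_eq]
    constructor
    · intro h
      obtain ⟨q, hq, h1, h2⟩ := ENNReal.lt_iff_exists_rat_btwn.1 h
      refine ⟨⟨q, ?_, h2⟩, h1.le⟩
      have := (zero_le (a := burningTime Ξ x.1 x.2 i)).trans_lt h1
      simpa using this
    · rintro ⟨⟨q, hq0, hq⟩, h⟩
      exact h.trans_lt hq
  rw [this]
  exact MeasurableSet.iUnion fun q => measurableSet_burningTime_le hΞ q.2.1 i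

lemma measurable_rootTime (hΞ : IsRelClosed Ξ) : Measurable (rootTime Ξ) :=
  measurable_burningTime hΞ []

lemma measurableSet_frozenEq (hΞ : IsRelClosed Ξ) :
    MeasurableSet {x : Conf | FrozenEq Ξ x.1 x.2} := by
  simp only [frozenEq_iff hΞ]
  refine (Measurable.forall fun i => Measurable.iff ?_
    (Measurable.and ?_ (Measurable.and ?_ ?_))).setOf
  · exact (measurable_set_mem i).comp measurable_snd
  · fun_prop
  · exact measurableSet_setOfPred.1 (measurableSet_lt measurable_const (measurable_mark_val i))
  · exact measurableSet_setOfPred.1 (measurableSet_le (measurable_burningTime hΞ _)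
      (ENNReal.measurable_ofReal.comp (measurable_mark_val i)))

end Measurability

/-! ### Passing to the joint law of marks and frozen set -/

section Transfer

variable {S : Type u} [MeasurableSpace S] {Ξ : Set ℝ} {P : Measure S} {ω : S → Word → Mark}
  {F : S → Set Word}

lemma iIndepFun_map_iff {T : Type*} [MeasurableSpace T] {X : S → T} (hX : Measurable X)
    {ι : Type*} {β : ι → Type*} [∀ i, MeasurableSpace (β i)] {f : ∀ i, T → β i}
    (hf : ∀ i, Measurable (f i)) :
    iIndepFun f (P.map X) ↔ iIndepFun (fun i => f i ∘ X) P := by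
  simp only [iIndepFun_iff_measure_inter_preimage_eq_mul]
  refine forall_congr' fun A => forall_congr' fun s => forall_congr' fun hs => ?_
  rw [Measure.map_apply hX (Finset.measurableSet_biInter _ fun i hi => hf i (hs i hi)),
    Finset.prod_congr rfl fun i hi => Measure.map_apply hX (hf i (hs i hi))]
  simp only [Set.preimage_iInter, Set.preimage_comp]

lemma indepFun_map_iff {T : Type*} [MeasurableSpace T] {X : S → T} (hX : Measurable X)
    {β γ : Type*} [MeasurableSpace β] [MeasurableSpace γ] {f : T → β} {g : T → γ}
    (hf : Measurable f) (hg : Measurable g) :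
    IndepFun f g (P.map X) ↔ IndepFun (f ∘ X) (g ∘ X) P := by
  simp only [indepFun_iff_measure_inter_preimage_eq_mul]
  refine forall_congr' fun s => forall_congr' fun t =>
    forall_congr' fun hs => forall_congr' fun ht => ?_
  rw [Measure.map_apply hX ((hf hs).inter (hg ht)), Measure.map_apply hX (hf hs),
    Measure.map_apply hX (hg ht)]
  rfl

/-- `F` is a solution relative to `ω` that is stationary, adapted and respects the tree
structure. -/
structure IsTreeSolution (Ξ : Set ℝ) (P : Measure S) (ω : S → Word → Mark)
    (F : S → Set Word) : Prop where
  marks : IsMarkField P ω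
  solution : IsFrozenSolution Ξ P ω F
  stationary : IsStationary P ω F
  adapted : IsAdapted P ω F
  tree : RespectsTree P ω F

/-- Every condition involved is a property of the joint law, so one may work on the canonical space,
and any coupling with the right marginal law is again a solution. -/
lemma isTreeSolution_map_iff (hΞ : IsRelClosed Ξ) (hω : Measurable ω) (hF : Measurable F) :
    IsTreeSolution Ξ (P.map fun s => (ω s, F s)) Prod.fst Prod.snd ↔ IsTreeSolution Ξ P ω F := by
  have hX : Measurable fun s => (ω s, F s) := hω.prodMk hF
  have hsh (j : Word) : Measurable (shiftPair (S := Conf) Prod.fst Prod.snd j) :=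
    measurable_shiftConf j
  have e1 : IsMarkField (P.map fun s => (ω s, F s)) Prod.fst ↔ IsMarkField P ω := by
    have hm (i : Word) : Measurable fun x : Conf => x.1 i := by fun_prop
    constructor
    · rintro ⟨-, h2, h3⟩
      refine ⟨hω, fun i => ?_, (iIndepFun_map_iff hX hm).1 h3⟩
      rw [← h2 i, Measure.map_map (hm i) hX]
      rfl
    · rintro ⟨-, h2, h3⟩
      refine ⟨measurable_fst, fun i => ?_, (iIndepFun_map_iff hX hm).2 h3⟩
      rw [← h2 i, Measure.map_map (hm i) hX]
      rfl
  have e2 : IsFrozenSolution Ξ (P.map fun s => (ω s, F s)) Prod.fst Prod.snd ↔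
      IsFrozenSolution Ξ P ω F := by
    have := ae_map_iff hX.aemeasurable (μ := P) (measurableSet_frozenEq hΞ)
    exact ⟨fun h => ⟨hF, this.1 h.2⟩, fun h => ⟨measurable_snd, this.2 h.2⟩⟩
  have e3 : IsStationary (P.map fun s => (ω s, F s)) Prod.fst Prod.snd ↔ IsStationary P ω F := by
    refine forall_congr' fun j => forall_congr' fun j' => ?_
    rw [Measure.map_map (hsh j) hX, Measure.map_map (hsh j') hX]
    rfl
  have e4 : IsAdapted (P.map fun s => (ω s, F s)) Prod.fst Prod.snd ↔ IsAdapted P ω F := by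
    refine forall_congr' fun U => forall_congr' fun _ => ?_
    exact indepFun_map_iff hX (measurable_pi_iff.2 fun j => hsh j) (by fun_prop)
  have e5 : RespectsTree (P.map fun s => (ω s, F s)) Prod.fst Prod.snd ↔ RespectsTree P ω F := by
    refine forall_congr' fun U => forall_congr' fun _ => ?_
    exact iIndepFun_map_iff hX fun j => hsh j
  exact ⟨fun h => ⟨e1.1 h.1, e2.1 h.2, e3.1 h.3, e4.1 h.4, e5.1 h.5⟩,
    fun h => ⟨e1.2 h.1, e2.2 h.2, e3.2 h.3, e4.2 h.4, e5.2 h.5⟩⟩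

end Transfer

/-! ### Independence at the root -/

section Law

variable {Ξ : Set ℝ} {Q : Measure Conf}

lemma isRootedSubtree_singleton : IsRootedSubtree {[]} := by
  intro i hi h
  exact absurd (Finset.mem_singleton.1 hi) h

lemma singleton_mem_treeBoundary (j : Fin 2) : [j] ∈ treeBoundary {[]} := by
  simp [treeBoundary]

lemma map_shiftConf_eq [IsProbabilityMeasure Q] (h : IsTreeSolution Ξ Q Prod.fst Prod.snd)
    (j : Word) : Q.map (shiftConf j) = Q := by
  have := h.stationary j []
  have h0 : shiftPair (S := Conf) Prod.fst Prod.snd [] = id := rfl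
  rw [h0, Measure.map_id] at this
  exact this

/-- The mark of the root and the configurations seen from its children are independent. -/
lemma map_decompose_eq [IsProbabilityMeasure Q] (h : IsTreeSolution Ξ Q Prod.fst Prod.snd) :
    Q.map decompose = markLaw.prod (Q.prod Q) := by
  let b (j : Fin 2) : treeBoundary {[]} := ⟨[j], singleton_mem_treeBoundary j⟩
  have h1 : IndepFun (fun x : Conf => (shiftConf [0] x, shiftConf [1] x)) (fun x => x.1 []) Q :=
    (h.adapted {[]} isRootedSubtree_singleton).comp
      (φ := fun f : treeBoundary {[]} → Conf => (f (b 0), f (b 1)))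
      (ψ := fun f : ({[]} : Finset Word) → Mark => f ⟨[], by simp⟩)
      (by fun_prop) (by fun_prop)
  have h2 : IndepFun (shiftConf [0]) (shiftConf [1]) Q :=
    (h.tree {[]} isRootedSubtree_singleton).indepFun (i := b 0) (j := b 1) (by simp [b])
  have h3 := (indepFun_iff_map_prod_eq_prod_map_map (by fun_prop) (by fun_prop)).1 h1.symm
  rw [(indepFun_iff_map_prod_eq_prod_map_map (by fun_prop) (by fun_prop)).1 h2,
    map_shiftConf_eq h, map_shiftConf_eq h] at h3
  have h4 : Q.map (fun x : Conf => x.1 []) = markLaw := h.marks.law []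
  rw [h4] at h3
  exact h3

end Law

/-! ### Probabilities for a single mark -/

section MarkLaw

lemma markLaw_apply_prod (A : Set unitInterval) (k : Fin 2) :
    markLaw (A ×ˢ {k}) = volume A / 2 := by
  have : uniformOn (Set.univ : Set (Fin 2)) {k} = 2⁻¹ := by
    rw [uniformOn_univ]
    simp
  rw [markLaw, Measure.prod_prod, this, div_eq_mul_inv]

lemma markLaw_branching : markLaw {m | m.2 = 1} = 1 / 2 := by
  have : {m : Mark | m.2 = 1} = Set.univ ×ˢ {1} := by ext m; simp
  rw [this, markLaw_apply_prod, measure_univ]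

lemma markLaw_internal_le {t : ℝ} (h0 : 0 ≤ t) (h1 : t ≤ 1) :
    markLaw {m | m.2 = 0 ∧ (m.1 : ℝ) ≤ t} = ENNReal.ofReal t / 2 := by
  have : {m : Mark | m.2 = 0 ∧ (m.1 : ℝ) ≤ t} = Set.Iic (⟨t, h0, h1⟩ : unitInterval) ×ˢ {0} := by
    ext m; simp [and_comm, ← Subtype.coe_le_coe]
  rw [this, markLaw_apply_prod, unitInterval.volume_Iic]

lemma markLaw_internal_lt {y : ENNReal} (h1 : y ≤ 1) :
    markLaw {m | m.2 = 0 ∧ ENNReal.ofReal m.1 < y} = y / 2 := by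
  have hy : y ≠ ⊤ := (h1.trans_lt ENNReal.one_lt_top).ne
  have h1' : y.toReal ≤ 1 := by
    rw [← ENNReal.toReal_one]; exact ENNReal.toReal_mono ENNReal.one_ne_top h1
  have : {m : Mark | m.2 = 0 ∧ ENNReal.ofReal m.1 < y} =
      Set.Iio (⟨y.toReal, ENNReal.toReal_nonneg, h1'⟩ : unitInterval) ×ˢ {0} := by
    ext m
    simp [and_comm, ← Subtype.coe_lt_coe, ENNReal.ofReal_lt_iff_lt_toReal m.1.2.1 hy]
  rw [this, markLaw_apply_prod, unitInterval.volume_Iio, ENNReal.ofReal_toReal hy]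

lemma markLaw_ae_pos : ∀ᵐ m ∂markLaw, 0 < (m.1 : ℝ) := by
  rw [ae_iff]
  have : {m : Mark | ¬ 0 < (m.1 : ℝ)} =
      Set.Iic (0 : unitInterval) ×ˢ {0} ∪ Set.Iic (0 : unitInterval) ×ˢ {1} := by
    ext ⟨m, k⟩
    fin_cases k <;> simp
  rw [this, measure_union_null_iff]
  simp only [markLaw_apply_prod, unitInterval.volume_Iic]
  simp

end MarkLaw

/-! ### The recursion for the law of the burning time -/

section Recursion

variable {Ξ : Set ℝ} {Q : Measure Conf}

/-- The law of a configuration that is recursively built from independent copies of itself. -/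
structure IsRecursiveLaw (Ξ : Set ℝ) (Q : Measure Conf) : Prop where
  map_decompose : Q.map decompose = markLaw.prod (Q.prod Q)
  frozenEq : ∀ᵐ x ∂Q, FrozenEq Ξ x.1 x.2
  pos : ∀ᵐ x ∂Q, 0 < ((x.1 []).1 : ℝ)

lemma IsTreeSolution.isRecursiveLaw [IsProbabilityMeasure Q]
    (h : IsTreeSolution Ξ Q Prod.fst Prod.snd) :
    IsRecursiveLaw Ξ Q where
  map_decompose := map_decompose_eq h
  frozenEq := h.solution.solves
  pos := by
    have h4 : Q.map (fun x : Conf => x.1 []) = markLaw := h.marks.law []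
    have := markLaw_ae_pos
    rw [← h4] at this
    exact ae_of_ae_map (f := fun x : Conf => x.1 []) (by fun_prop) this

lemma rootTime_eq_burningMap (hΞ : IsRelClosed Ξ) {x : Conf} (hx : FrozenEq Ξ x.1 x.2)
    (h0 : 0 < ((x.1 []).1 : ℝ)) :
    rootTime Ξ x = burningMap (decompose x).1 (rootTime Ξ (decompose x).2.1)
      (rootTime Ξ (decompose x).2.2) := by
  have := burningTime_eq_burningMap hΞ hx h0
  rw [burningTime_eq_rootTime, burningTime_eq_rootTime] at this
  exact this

lemma IsRecursiveLaw.apply_eq (hQ : IsRecursiveLaw Ξ Q) {E : Set Conf}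
    {E' : Set (Mark × Conf × Conf)} (hE' : MeasurableSet E')
    (h : ∀ x : Conf, FrozenEq Ξ x.1 x.2 → 0 < ((x.1 []).1 : ℝ) → (x ∈ E ↔ decompose x ∈ E')) :
    Q E = markLaw.prod (Q.prod Q) E' := by
  rw [← hQ.map_decompose, Measure.map_apply measurable_decompose hE']
  refine measure_congr ?_
  filter_upwards [hQ.frozenEq, hQ.pos] with x h1 h2
  exact propext (h x h1 h2)

lemma measurableSet_mark_lt_rootTime (hΞ : IsRelClosed Ξ) :
    MeasurableSet {z : Mark × Conf × Conf | ENNReal.ofReal z.1.1 < rootTime Ξ z.2.1} :=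
  measurableSet_lt (by fun_prop) ((measurable_rootTime hΞ).comp (by fun_prop))

lemma measurableSet_internal : MeasurableSet {z : Mark × Conf × Conf | z.1.2 = 0} :=
  (by fun_prop : Measurable fun z : Mark × Conf × Conf => z.1.2 = 0).setOf

lemma measurableSet_branching : MeasurableSet {z : Mark × Conf × Conf | z.1.2 = 1} :=
  (by fun_prop : Measurable fun z : Mark × Conf × Conf => z.1.2 = 1).setOf

/-- The event that the root is internal and burns at a time in `J`. -/
def internalEvent (Ξ : Set ℝ) (J : Set ENNReal) : Set (Mark × Conf × Conf) :=
  {z | z.1.2 = 0 ∧ ENNReal.ofReal z.1.1 < rootTime Ξ z.2.1 ∧ rootTime Ξ z.2.1 ∈ J}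

lemma measurableSet_internalEvent (hΞ : IsRelClosed Ξ) {J : Set ENNReal} (hJ : MeasurableSet J) :
    MeasurableSet (internalEvent Ξ J) :=
  measurableSet_internal.inter ((measurableSet_mark_lt_rootTime hΞ).inter
    (((measurable_rootTime hΞ).comp
      (by fun_prop : Measurable fun z : Mark × Conf × Conf => z.2.1)) hJ))

/-- The law of the burning time of the root. -/
noncomputable def burningLaw (Ξ : Set ℝ) (Q : Measure Conf) : Measure ENNReal := Q.map (rootTime Ξ)

/-- Given that the child burns at `s ∈ J`, the root mark must be internal with `τ < s`. This has
probability `s / 2`, because `s ≤ 1`. -/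
lemma prod_internalEvent [IsProbabilityMeasure Q] (hΞ : IsRelClosed Ξ)
    {J : Set ENNReal} (hJ : MeasurableSet J) (hJ1 : J ⊆ Set.Iic 1) :
    markLaw.prod (Q.prod Q) (internalEvent Ξ J) = (∫⁻ s in J, s ∂(burningLaw Ξ Q)) / 2 := by
  have hm : Measurable (J.indicator fun s : ENNReal => s / 2) :=
    (measurable_id.div_const 2).indicator hJ
  rw [Measure.prod_apply_symm (measurableSet_internalEvent hΞ hJ)]
  have : ∀ y : Conf × Conf, markLaw ((fun m => (m, y)) ⁻¹' internalEvent Ξ J) =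
      J.indicator (fun s => s / 2) (rootTime Ξ y.1) := by
    intro y
    by_cases hy : rootTime Ξ y.1 ∈ J
    · rw [Set.indicator_of_mem hy, ← markLaw_internal_lt (hJ1 hy)]
      simp [internalEvent, hy]
    · simp [internalEvent, hy]
  simp_rw [this]
  have h2 : ∫⁻ y : Conf × Conf, J.indicator (fun s => s / 2) (rootTime Ξ y.1) ∂(Q.prod Q) =
      ∫⁻ x, J.indicator (fun s => s / 2) (rootTime Ξ x) ∂Q :=
    (measurePreserving_fst (μ := Q) (ν := Q)).lintegral_comp (hm.comp (measurable_rootTime hΞ))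
  rw [h2, ← lintegral_map hm (measurable_rootTime hΞ), lintegral_indicator hJ, burningLaw]
  simp_rw [div_eq_mul_inv]
  rw [lintegral_mul_const _ measurable_id']

/-- Inclusion–exclusion for two independent children, written additively to avoid truncated
subtraction. -/
lemma prod_branching_union [IsProbabilityMeasure Q] {E : Set Conf} (hE : MeasurableSet E) :
    markLaw.prod (Q.prod Q) {z | z.1.2 = 1 ∧ (z.2.1 ∈ E ∨ z.2.2 ∈ E)} + Q E ^ 2 / 2 = Q E := by
  have e1 : {z : Mark × Conf × Conf | z.1.2 = 1 ∧ (z.2.1 ∈ E ∨ z.2.2 ∈ E)} =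
      {m : Mark | m.2 = 1} ×ˢ (E ×ˢ Set.univ ∪ Set.univ ×ˢ E) := by
    ext z; simp [and_or_left]
  have e2 := measure_union_add_inter (μ := Q.prod Q) (E ×ˢ Set.univ)
    (MeasurableSet.univ.prod hE : MeasurableSet (Set.univ ×ˢ E : Set (Conf × Conf)))
  rw [Set.prod_inter_prod, Set.inter_univ, Set.univ_inter] at e2
  simp only [Measure.prod_prod, measure_univ, one_mul, mul_one] at e2
  rw [e1, Measure.prod_prod, markLaw_branching, one_div, pow_two, div_eq_mul_inv, mul_comm _ 2⁻¹,
    ← mul_add, e2, ← two_mul, ← mul_assoc, ENNReal.inv_mul_cancel (by simp) (by simp), one_mul]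

lemma burningLaw_apply (hΞ : IsRelClosed Ξ) {J : Set ENNReal} (hJ : MeasurableSet J) :
    burningLaw Ξ Q J = Q {x | rootTime Ξ x ∈ J} :=
  Measure.map_apply (measurable_rootTime hΞ) hJ

lemma top_notMem_of_subset {J : Set ENNReal} (hJ1 : J ⊆ Set.Iic 1) : ⊤ ∉ J := fun h => by
  have := hJ1 h
  simp at this

/-- A branching root burns in `J` with probability `μ(J) - μ(J)²/2`, so `μ(J)` cancels and the
internal roots must supply the missing square. That `J` is a lower set makes a minimum lie in `J` as
soon as one argument does. -/
lemma IsRecursiveLaw.sq_burningLaw [IsProbabilityMeasure Q] (hΞ : IsRelClosed Ξ)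
    (hQ : IsRecursiveLaw Ξ Q) {J : Set ENNReal}
    (hJ : MeasurableSet J) (hl : IsLowerSet J) (hJ1 : J ⊆ Set.Iic 1) :
    burningLaw Ξ Q J ^ 2 / 2 = markLaw.prod (Q.prod Q) (internalEvent Ξ J) := by
  have hE : MeasurableSet {x : Conf | rootTime Ξ x ∈ J} := measurable_rootTime hΞ hJ
  have hB : MeasurableSet {z : Mark × Conf × Conf | z.1.2 = 1 ∧
      (z.2.1 ∈ {x : Conf | rootTime Ξ x ∈ J} ∨ z.2.2 ∈ {x : Conf | rootTime Ξ x ∈ J})} :=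
    measurableSet_branching.inter
      (((by fun_prop : Measurable fun z : Mark × Conf × Conf => z.2.1) hE).union
        ((by fun_prop : Measurable fun z : Mark × Conf × Conf => z.2.2) hE))
  have h1 := hQ.apply_eq (E := {x | rootTime Ξ x ∈ J})
    ((measurableSet_internalEvent hΞ hJ).union hB) (fun x hx h0 => by
      have ht := top_notMem_of_subset hJ1
      rw [Set.mem_ofPred_eq, rootTime_eq_burningMap hΞ hx h0]
      generalize decompose x = z
      obtain ⟨⟨τ, k⟩, y₀, y₁⟩ := z
      fin_cases k
      · by_cases hle : rootTime Ξ y₀ ≤ ENNReal.ofReal τ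
        · simp [burningMap, internalEvent, hle, ht]
        · simp [burningMap, internalEvent, hle, not_le.1 hle]
      · have : min (rootTime Ξ y₀) (rootTime Ξ y₁) ∈ J ↔ rootTime Ξ y₀ ∈ J ∨ rootTime Ξ y₁ ∈ J := by
          constructor
          · intro h
            rcases min_choice (rootTime Ξ y₀) (rootTime Ξ y₁) with h' | h' <;> rw [h'] at h
            exacts [Or.inl h, Or.inr h]
          · rintro (h | h)
            exacts [hl (min_le_left _ _) h, hl (min_le_right _ _) h]
        simpa [burningMap, internalEvent] using this)
  rw [measure_union _ hB] at h1
  · have h2 := prod_branching_union (Q := Q) hE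
    rw [burningLaw_apply hΞ hJ]
    rw [add_comm] at h1
    have h3 := h2.trans h1
    exact (ENNReal.add_right_inj (ne_top_of_le_ne_top (measure_ne_top _ _) le_rfl)).1 h3
  · rw [Set.disjoint_left]
    rintro z ⟨h0, -⟩ ⟨h1, -⟩
    rw [h0] at h1
    simp at h1

end Recursion

/-! ### Survival probabilities and the lower bound on the burning law -/

section Survival

variable {Ξ : Set ℝ} {Q : Measure Conf}

lemma IsRecursiveLaw.sq_burningLaw_eq_lintegral [IsProbabilityMeasure Q] (hΞ : IsRelClosed Ξ)
    (hQ : IsRecursiveLaw Ξ Q) {J : Set ENNReal}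
    (hJ : MeasurableSet J) (hl : IsLowerSet J) (hJ1 : J ⊆ Set.Iic 1) :
    burningLaw Ξ Q J ^ 2 = ∫⁻ s in J, s ∂(burningLaw Ξ Q) := by
  have h := (hQ.sq_burningLaw hΞ hJ hl hJ1).trans (prod_internalEvent hΞ hJ hJ1)
  rwa [ENNReal.div_eq_div_iff (by simp) (by simp) (by simp) (by simp),
    ENNReal.mul_right_inj (by simp) (by simp)] at h

/-- The root percolates at time `t` for at least `n` steps. -/
def survivalEvent (t : ℝ) (n : ℕ) : Set Conf :=
  {x | PercolatesUpTo x.1 (activeSet x.1 t \ x.2) n []}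

lemma measurableSet_survivalEvent (t : ℝ) (n : ℕ) : MeasurableSet (survivalEvent t n) :=
  (measurable_percolatesUpTo t n []).setOf

lemma antitone_survivalEvent (t : ℝ) : Antitone (survivalEvent t) :=
  fun _ _ hmn _ hx => antitone_percolatesUpTo _ _ _ hmn hx

lemma iInter_survivalEvent (hΞ : IsRelClosed Ξ) {t : ℝ} (ht : t ∈ Ξ) :
    ⋂ n, survivalEvent t n = {x | rootTime Ξ x ∈ Set.Iic (ENNReal.ofReal t)} := by
  ext x
  rw [Set.mem_iInter, Set.mem_ofPred_eq, Set.mem_Iic, rootTime,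
    burningTime_le_ofReal_iff_percolates hΞ ht, percolates_iff_forall]
  rfl

lemma mem_survivalEvent_succ_iff (hΞ : IsRelClosed Ξ) {x : Conf} {t : ℝ} (n : ℕ)
    (hx : FrozenEq Ξ x.1 x.2) (h0 : 0 < ((x.1 []).1 : ℝ)) :
    x ∈ survivalEvent t (n + 1) ↔
      ((decompose x).1.2 = 0 ∧ ((decompose x).1.1 : ℝ) ≤ t ∧
        ENNReal.ofReal (decompose x).1.1 < rootTime Ξ (decompose x).2.1 ∧
        (decompose x).2.1 ∈ survivalEvent t n) ∨
      ((decompose x).1.2 = 1 ∧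
        ((decompose x).2.1 ∈ survivalEvent t n ∨ (decompose x).2.2 ∈ survivalEvent t n)) := by
  have hmem := (frozenEq_iff hΞ).1 hx []
  rw [burningTime_eq_rootTime] at hmem
  have hs (j : Fin 2) : PercolatesUpTo x.1 (activeSet x.1 t \ x.2) n [j] ↔
      shiftConf [j] x ∈ survivalEvent t n := by
    have := percolatesUpTo_append (w := x.1) (A := activeSet x.1 t \ x.2) (j := [j]) (n := n)
      (i := [])
    rw [preimage_activeSet_diff] at this
    exact this
  have e : x ∈ survivalEvent t (n + 1) ↔ [] ∈ activeSet x.1 t \ x.2 ∧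
      (0 ≤ (x.1 []).2 ∧ shiftConf [0] x ∈ survivalEvent t n ∨
        1 ≤ (x.1 []).2 ∧ shiftConf [1] x ∈ survivalEvent t n) := by
    rw [← hs 0, ← hs 1]
    exact and_congr_right fun _ => Fin.exists_fin_two
  rw [e, Set.mem_sdiff, hmem]
  simp only [decompose]
  obtain hk | hk : (x.1 []).2 = 0 ∨ (x.1 []).2 = 1 := by omega
  · simp [activeSet, hk, h0, and_assoc]
  · simp [activeSet, hk]

/-- Survival through an internal root (`C`) is found by removing the roots frozen by time `t` (`D`)
from a product event. The probability of `D` in turn is `t p / 2` minus that of `internalEvent`,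
which is `p² / 2` by `IsRecursiveLaw.sq_burningLaw`. -/
lemma IsRecursiveLaw.survival_succ [IsProbabilityMeasure Q] (hΞ : IsRelClosed Ξ)
    (hQ : IsRecursiveLaw Ξ Q) {t : ℝ} (ht : t ∈ Ξ) (n : ℕ) {p : ℝ}
    (hp : p = (burningLaw Ξ Q).real (Set.Iic (ENNReal.ofReal t))) :
    2 * (Q.real (survivalEvent t (n + 1)) - Q.real (survivalEvent t n)) =
      (Q.real (survivalEvent t n) - p) * (t - Q.real (survivalEvent t n) - p) := by
  have ht0 := (hΞ.1 ht).1
  have ht1 := (hΞ.1 ht).2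
  set R := markLaw.prod (Q.prod Q) with hR
  have hE := measurableSet_survivalEvent t n
  have hY : MeasurableSet {x : Conf | rootTime Ξ x ∈ Set.Iic (ENNReal.ofReal t)} :=
    measurable_rootTime hΞ measurableSet_Iic
  have m1 : Measurable fun z : Mark × Conf × Conf => z.2.1 := by fun_prop
  have m2 : Measurable fun z : Mark × Conf × Conf => z.2.2 := by fun_prop
  have hT : MeasurableSet {z : Mark × Conf × Conf | (z.1.1 : ℝ) ≤ t} :=
    measurableSet_le (by fun_prop) measurable_const
  let C : Set (Mark × Conf × Conf) := {z | z.1.2 = 0 ∧ (z.1.1 : ℝ) ≤ t ∧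
    ENNReal.ofReal z.1.1 < rootTime Ξ z.2.1 ∧ z.2.1 ∈ survivalEvent t n}
  let D : Set (Mark × Conf × Conf) := {z | z.1.2 = 0 ∧ (z.1.1 : ℝ) ≤ t ∧
    ¬ ENNReal.ofReal z.1.1 < rootTime Ξ z.2.1}
  let B : Set (Mark × Conf × Conf) :=
    {z | z.1.2 = 1 ∧ (z.2.1 ∈ survivalEvent t n ∨ z.2.2 ∈ survivalEvent t n)}
  have hC : MeasurableSet C := measurableSet_internal.inter (hT.inter
    ((measurableSet_mark_lt_rootTime hΞ).inter (m1 hE)))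
  have hD : MeasurableSet D := measurableSet_internal.inter (hT.inter
    (measurableSet_mark_lt_rootTime hΞ).compl)
  have hB : MeasurableSet B := measurableSet_branching.inter ((m1 hE).union (m2 hE))
  have hA := measurableSet_internalEvent hΞ (measurableSet_Iic (a := ENNReal.ofReal t))
  have hJ1 : Set.Iic (ENNReal.ofReal t) ⊆ Set.Iic 1 := Set.Iic_subset_Iic.2 (by simpa using ht1)
  have hrect (G : Set Conf) : R.real ({m | m.2 = 0 ∧ (m.1 : ℝ) ≤ t} ×ˢ (G ×ˢ Set.univ)) =
      t / 2 * Q.real G := by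
    rw [measureReal_prod_prod, measureReal_prod_prod, probReal_univ, mul_one, measureReal_def,
      markLaw_internal_le ht0.le ht1, ENNReal.toReal_div, ENNReal.toReal_ofReal ht0.le]
    simp
  have hle {z : Mark × Conf × Conf} (hz : (z.1.1 : ℝ) ≤ t)
      (hlt : ¬ ENNReal.ofReal z.1.1 < rootTime Ξ z.2.1) :
      rootTime Ξ z.2.1 ≤ ENNReal.ofReal t :=
    (not_lt.1 hlt).trans (ENNReal.ofReal_le_ofReal hz)
  have e1 : Q.real (survivalEvent t (n + 1)) = R.real C + R.real B := by
    rw [← measureReal_union _ hB, measureReal_def, measureReal_def,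
      hQ.apply_eq (hC.union hB) fun x hx h0 => mem_survivalEvent_succ_iff hΞ n hx h0]
    rw [Set.disjoint_left]
    rintro z ⟨h0, -⟩ ⟨h1, -⟩
    rw [h0] at h1
    simp at h1
  have e2 : R.real C + R.real D = t / 2 * Q.real (survivalEvent t n) := by
    rw [← hrect, ← measureReal_union _ hD]
    · congr 1
      ext z
      simp only [C, D, Set.mem_union, Set.mem_ofPred_eq, Set.mem_prod, Set.mem_univ, and_true]
      -- On `D` the child percolates at time `t`, hence survives any number of steps.
      have : (z.1.1 : ℝ) ≤ t → ¬ ENNReal.ofReal z.1.1 < rootTime Ξ z.2.1 →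
          z.2.1 ∈ survivalEvent t n := fun h1 h2 => by
        have h3 : z.2.1 ∈ {x | rootTime Ξ x ∈ Set.Iic (ENNReal.ofReal t)} := hle h1 h2
        rw [← iInter_survivalEvent hΞ ht] at h3
        exact Set.mem_iInter.1 h3 n
      tauto
    · rw [Set.disjoint_left]
      rintro z ⟨-, -, h, -⟩ ⟨-, -, h'⟩
      exact h' h
  have e3 : R.real D + R.real (internalEvent Ξ (Set.Iic (ENNReal.ofReal t))) = t / 2 * p := by
    rw [hp, measureReal_def (burningLaw Ξ Q), burningLaw_apply hΞ measurableSet_Iic,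
      ← measureReal_def, ← hrect, ← measureReal_union _ hA]
    · congr 1
      ext z
      simp only [D, internalEvent, Set.mem_union, Set.mem_ofPred_eq, Set.mem_prod, Set.mem_univ,
        and_true, Set.mem_Iic]
      have h1 := hle (z := z)
      have h2 : ENNReal.ofReal z.1.1 < rootTime Ξ z.2.1 → rootTime Ξ z.2.1 ≤ ENNReal.ofReal t →
          (z.1.1 : ℝ) ≤ t := fun h h' => by
        have := h.trans_le h'
        rw [ENNReal.ofReal_lt_ofReal_iff ht0] at this
        exact this.le
      tauto
    · rw [Set.disjoint_left]
      rintro z ⟨-, -, h⟩ ⟨-, h', -⟩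
      exact h h'
  have e4 : R.real (internalEvent Ξ (Set.Iic (ENNReal.ofReal t))) = p ^ 2 / 2 := by
    rw [measureReal_def, ← hQ.sq_burningLaw hΞ measurableSet_Iic (isLowerSet_Iic _) hJ1, hp]
    simp [measureReal_def]
  have e5 : R.real B + Q.real (survivalEvent t n) ^ 2 / 2 = Q.real (survivalEvent t n) := by
    have := congrArg ENNReal.toReal (prod_branching_union (Q := Q) hE)
    rw [ENNReal.toReal_add (measure_ne_top _ _)
      (ENNReal.div_ne_top (ENNReal.pow_ne_top (measure_ne_top _ _)) (by simp))] at this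
    simpa [measureReal_def] using this
  linear_combination 2 * e1 + 2 * e2 - 2 * e3 + 2 * e4 + 2 * e5

/-- At a possible freezing time `t`, the root has burnt with probability at least `t / 2`. -/
lemma IsRecursiveLaw.half_le [IsProbabilityMeasure Q] (hΞ : IsRelClosed Ξ)
    (hQ : IsRecursiveLaw Ξ Q) {t : ℝ} (ht : t ∈ Ξ) :
    t ≤ 2 * (burningLaw Ξ Q).real (Set.Iic (ENNReal.ofReal t)) := by
  have ht0 := (hΞ.1 ht).1
  have ht1 := (hΞ.1 ht).2
  obtain ⟨p, hp⟩ : ∃ p, p = (burningLaw Ξ Q).real (Set.Iic (ENNReal.ofReal t)) := ⟨_, rfl⟩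
  obtain ⟨q, hq⟩ : ∃ q : ℕ → ℝ, q = fun n => Q.real (survivalEvent t n) := ⟨_, rfl⟩
  have hrec (n : ℕ) : 2 * (q (n + 1) - q n) = (q n - p) * (t - q n - p) := by
    rw [hq]; exact hQ.survival_succ hΞ ht n hp
  rw [← hp]
  by_contra! hlt
  have hq1 (n : ℕ) : q n ≤ 1 := by rw [hq]; exact measureReal_le_one
  have hgt (n : ℕ) : p < q n := by
    induction n with
    | zero =>
      have : q 0 = 1 := by
        have : survivalEvent t 0 = Set.univ := by ext; simp [survivalEvent, PercolatesUpTo]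
        simp [hq, this]
      linarith
    | succ n ih =>
      have := hrec n
      have h1 := hq1 n
      -- The recursion reads `2 (q (n+1) - p) = (q n - p) (2 + t - q n - p)`.
      nlinarith [mul_pos (sub_pos.2 ih) (show 0 < 2 + t - q n - p by linarith)]
  have hanti (n : ℕ) : q (n + 1) ≤ q n := by
    rw [hq]; exact measureReal_mono (antitone_survivalEvent t n.le_succ)
  -- Below `t - p` the recursion would make `q` increase strictly, against `hanti`. In the limit `p
  -- ≥ t - p`, contradicting `hlt`.
  have hge (n : ℕ) : t - p ≤ q n := by
    by_contra! h
    have := hrec n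
    have h1 := hanti n
    nlinarith [mul_pos (sub_pos.2 (hgt n)) (show 0 < t - q n - p by linarith)]
  have hlim : Filter.Tendsto q Filter.atTop (nhds p) := by
    have := tendsto_measure_iInter_atTop (μ := Q)
      (fun n => (measurableSet_survivalEvent t n).nullMeasurableSet) (antitone_survivalEvent t)
      ⟨0, measure_ne_top _ _⟩
    rw [iInter_survivalEvent hΞ ht, ← burningLaw_apply hΞ measurableSet_Iic] at this
    rw [hq, hp]
    refine (ENNReal.tendsto_toReal ?_).comp this
    rw [burningLaw_apply hΞ measurableSet_Iic]
    exact measure_ne_top _ _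
  have := ge_of_tendsto' hlim hge
  linarith

end Survival

/-! ### Uniqueness of the burning law -/

section Uniqueness

variable {Ξ : Set ℝ} {Q Q' : Measure Conf}

lemma isProbabilityMeasure_burningLaw (hΞ : IsRelClosed Ξ) (Q : Measure Conf)
    [IsProbabilityMeasure Q] : IsProbabilityMeasure (burningLaw Ξ Q) :=
  Measure.isProbabilityMeasure_map (measurable_rootTime hΞ).aemeasurable

/-- Integration by parts: the square is split along its diagonal, and ties are counted in the first
integral. -/
lemma measure_Iic_mul_measure_Iic (μ ν : Measure ENNReal) [SFinite μ] [SFinite ν] (t : ENNReal) :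
    μ (Set.Iic t) * ν (Set.Iic t) =
      ∫⁻ s in Set.Iic t, ν (Set.Iic s) ∂μ + ∫⁻ s in Set.Iic t, μ (Set.Iio s) ∂ν := by
  have hA : MeasurableSet {z : ENNReal × ENNReal | z.2 ≤ z.1 ∧ z.1 ≤ t} :=
    (measurableSet_le measurable_snd measurable_fst).inter
      (measurableSet_le measurable_fst measurable_const)
  have hB : MeasurableSet {z : ENNReal × ENNReal | z.1 < z.2 ∧ z.2 ≤ t} :=
    (measurableSet_lt measurable_fst measurable_snd).inter
      (measurableSet_le measurable_snd measurable_const)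
  have e : Set.Iic t ×ˢ Set.Iic t = {z : ENNReal × ENNReal | z.2 ≤ z.1 ∧ z.1 ≤ t} ∪
      {z : ENNReal × ENNReal | z.1 < z.2 ∧ z.2 ≤ t} := by
    ext ⟨x, y⟩
    simp only [Set.mem_prod, Set.mem_Iic, Set.mem_union, Set.mem_ofPred_eq]
    constructor
    · rintro ⟨h1, h2⟩
      rcases le_or_gt y x with h | h
      exacts [Or.inl ⟨h, h1⟩, Or.inr ⟨h, h2⟩]
    · rintro (⟨h, h1⟩ | ⟨h, h1⟩)
      exacts [⟨h1, h.trans h1⟩, ⟨h.le.trans h1, h1⟩]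
  rw [← Measure.prod_prod, e, measure_union _ hB, Measure.prod_apply hA, Measure.prod_apply_symm hB,
    ← lintegral_indicator measurableSet_Iic, ← lintegral_indicator measurableSet_Iic]
  · congr 1
    · refine lintegral_congr fun x => ?_
      by_cases hx : x ≤ t
      · rw [Set.indicator_of_mem (Set.mem_Iic.2 hx)]
        congr 1; ext y; simp [hx]
      · rw [Set.indicator_of_notMem (by simpa using hx)]
        simp [hx]
    · refine lintegral_congr fun y => ?_
      by_cases hy : y ≤ t
      · rw [Set.indicator_of_mem (Set.mem_Iic.2 hy)]
        congr 1; ext x; simp [hy]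
      · rw [Set.indicator_of_notMem (by simpa using hy)]
        simp [hy]
  · rw [Set.disjoint_left]
    rintro z ⟨h, -⟩ ⟨h', -⟩
    exact absurd h (not_le.2 h')

/-- Without an atom at `t` this is `IsRecursiveLaw.half_le`. With an atom, the quadratic identities
on `[0,t]` and `[0,t)` force equality. -/
lemma IsRecursiveLaw.le_add [IsProbabilityMeasure Q] (hΞ : IsRelClosed Ξ)
    (hQ : IsRecursiveLaw Ξ Q) {t : ℝ} (ht : t ∈ Ξ) :
    ENNReal.ofReal t ≤ burningLaw Ξ Q (Set.Iic (ENNReal.ofReal t)) +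
      burningLaw Ξ Q (Set.Iio (ENNReal.ofReal t)) := by
  have := isProbabilityMeasure_burningLaw hΞ Q
  obtain ⟨r, hr⟩ : ∃ r, r = ENNReal.ofReal t := ⟨_, rfl⟩
  have hr1 : r ≤ 1 := by simpa [hr] using (hΞ.1 ht).2
  have hrt : r ≠ ⊤ := by rw [hr]; simp
  have h2 : r ≤ 2 * burningLaw Ξ Q (Set.Iic r) := by
    have := hQ.half_le hΞ ht
    rw [hr]
    refine ENNReal.ofReal_le_of_le_toReal ?_
    simpa [measureReal_def] using this
  rw [← hr]
  have e1 := hQ.sq_burningLaw_eq_lintegral hΞ measurableSet_Iic (isLowerSet_Iic r)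
    (Set.Iic_subset_Iic.2 hr1)
  have e2 := hQ.sq_burningLaw_eq_lintegral hΞ measurableSet_Iio (isLowerSet_Iio r)
    (fun s hs => (le_of_lt hs).trans hr1)
  have hd : Disjoint (Set.Iio r) {r} := by simp
  have hu : Set.Iic r = Set.Iio r ∪ {r} := by ext s; simp [le_iff_lt_or_eq]
  have e3 : burningLaw Ξ Q (Set.Iic r) = burningLaw Ξ Q (Set.Iio r) + burningLaw Ξ Q {r} := by
    rw [hu, measure_union hd (measurableSet_singleton r)]
  rw [hu, lintegral_union (measurableSet_singleton r) hd, ← e2, ← hu,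
    lintegral_singleton, e3] at e1
  rw [e3] at h2 ⊢
  revert e1 h2
  generalize hb : burningLaw Ξ Q (Set.Iio r) = b
  generalize hc : burningLaw Ξ Q {r} = c
  have hb' : b ≠ ⊤ := by rw [← hb]; exact measure_ne_top _ _
  have hc' : c ≠ ⊤ := by rw [← hc]; exact measure_ne_top _ _
  lift b to NNReal using hb'
  lift c to NNReal using hc'
  lift r to NNReal using hrt
  norm_cast
  intro h2 e1
  rcases eq_or_ne c 0 with h0 | h0
  · subst h0
    rw [add_zero] at h2 ⊢
    rwa [← two_mul]
  · have : (c : ℝ) ≠ 0 := by exact_mod_cast h0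
    rw [← NNReal.coe_inj] at e1
    push_cast at e1
    rw [← NNReal.coe_le_coe]
    push_cast
    -- Subtracting the identities left `(b + c)² = b² + r c`; divide by `c`.
    have : (r : ℝ) = 2 * b + c := mul_right_cancel₀ this (by linear_combination -e1)
    linarith

lemma ae_burningLaw (hΞ : IsRelClosed Ξ) {p : ENNReal → Prop} (hp : MeasurableSet {s | p s})
    (h : ∀ x, p (rootTime Ξ x)) : ∀ᵐ s ∂(burningLaw Ξ Q), p s :=
  (ae_map_iff (measurable_rootTime hΞ).aemeasurable hp).2 (Filter.Eventually.of_forall h)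

lemma measurable_measure_Iic (μ : Measure ENNReal) : Measurable fun s => μ (Set.Iic s) :=
  (show Monotone fun s => μ (Set.Iic s) from
    fun _ _ h => measure_mono (Set.Iic_subset_Iic.2 h)).measurable

lemma measurable_measure_Iio (μ : Measure ENNReal) : Measurable fun s => μ (Set.Iio s) :=
  (show Monotone fun s => μ (Set.Iio s) from
    fun _ _ h => measure_mono (Set.Iio_subset_Iio h)).measurable

/-- The bound for `Q'` holds on `Ξ`, and burning times under `Q` lie in `Ξ ∪ {0, ∞}`, so it may be
integrated against the other law. -/
lemma IsRecursiveLaw.setLIntegral_le [IsProbabilityMeasure Q'] (hΞ : IsRelClosed Ξ)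
    (hQ' : IsRecursiveLaw Ξ Q') {t : ENNReal} (ht : t ≤ 1) :
    ∫⁻ s in Set.Iic t, s ∂(burningLaw Ξ Q) ≤
      ∫⁻ s in Set.Iic t, burningLaw Ξ Q' (Set.Iic s) ∂(burningLaw Ξ Q) +
        ∫⁻ s in Set.Iic t, burningLaw Ξ Q' (Set.Iio s) ∂(burningLaw Ξ Q) := by
  rw [← lintegral_add_left (measurable_measure_Iic _)]
  refine setLIntegral_mono_ae
    ((measurable_measure_Iic _).add (measurable_measure_Iio _)).aemeasurable ?_
  refine ae_burningLaw hΞ (p := fun s => s ∈ Set.Iic t → s ≤ burningLaw Ξ Q' (Set.Iic s) +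
    burningLaw Ξ Q' (Set.Iio s)) ?_ fun x hx => ?_
  · exact (measurableSet_Iic.mem.imp (measurableSet_setOfPred.1 (measurableSet_le measurable_id
      ((measurable_measure_Iic _).add (measurable_measure_Iio _))))).setOf
  · rcases eq_or_ne (rootTime Ξ x) 0 with h0 | h0
    · rw [h0]; exact zero_le
    · have htop : rootTime Ξ x ≠ ⊤ :=
        ((Set.mem_Iic.1 hx).trans ht |>.trans_lt ENNReal.one_lt_top).ne
      have h := mem_of_burningTime_eq hΞ (ENNReal.toReal_pos h0 htop)
        (ENNReal.ofReal_toReal htop).symm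
      have := hQ'.le_add hΞ h
      rwa [ENNReal.ofReal_toReal htop] at this

/-- The burning time of the root has the same law for all recursive laws. -/
lemma IsRecursiveLaw.burningLaw_eq [IsProbabilityMeasure Q] [IsProbabilityMeasure Q']
    (hΞ : IsRelClosed Ξ) (hQ : IsRecursiveLaw Ξ Q) (hQ' : IsRecursiveLaw Ξ Q') :
    burningLaw Ξ Q = burningLaw Ξ Q' := by
  have i1 := isProbabilityMeasure_burningLaw hΞ Q
  have i2 := isProbabilityMeasure_burningLaw hΞ Q'
  have key {t : ENNReal} (ht : t ≤ 1) :
      burningLaw Ξ Q (Set.Iic t) = burningLaw Ξ Q' (Set.Iic t) := by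
    have h1 := measure_Iic_mul_measure_Iic (burningLaw Ξ Q) (burningLaw Ξ Q') t
    have h2 := measure_Iic_mul_measure_Iic (burningLaw Ξ Q') (burningLaw Ξ Q) t
    have h3 := hQ'.setLIntegral_le (Q := Q) hΞ ht
    have h4 := hQ.setLIntegral_le (Q := Q') hΞ ht
    rw [← hQ.sq_burningLaw_eq_lintegral hΞ measurableSet_Iic (isLowerSet_Iic t)
      (Set.Iic_subset_Iic.2 ht)] at h3
    rw [← hQ'.sq_burningLaw_eq_lintegral hΞ measurableSet_Iic (isLowerSet_Iic t)
      (Set.Iic_subset_Iic.2 ht)] at h4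
    have h5 : burningLaw Ξ Q (Set.Iic t) ^ 2 + burningLaw Ξ Q' (Set.Iic t) ^ 2 ≤
        burningLaw Ξ Q (Set.Iic t) * burningLaw Ξ Q' (Set.Iic t) +
        burningLaw Ξ Q' (Set.Iic t) * burningLaw Ξ Q (Set.Iic t) := by
      refine (add_le_add h3 h4).trans (le_of_eq ?_)
      -- Both orders of integration by parts are needed: together they account for all four
      -- integrals.
      rw [h1, h2]
      abel
    revert h5
    generalize ha : burningLaw Ξ Q (Set.Iic t) = a
    generalize hb : burningLaw Ξ Q' (Set.Iic t) = b
    have ha' : a ≠ ⊤ := by rw [← ha]; exact measure_ne_top _ _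
    have hb' : b ≠ ⊤ := by rw [← hb]; exact measure_ne_top _ _
    lift a to NNReal using ha'
    lift b to NNReal using hb'
    norm_cast
    intro h5
    rw [← NNReal.coe_le_coe] at h5
    push_cast at h5
    rw [← NNReal.coe_inj]
    have : ((a : ℝ) - b) ^ 2 = 0 := le_antisymm (by linarith) (sq_nonneg _)
    exact sub_eq_zero.1 (pow_eq_zero_iff two_ne_zero |>.1 this)
  -- No burning time falls in `(1, ∞)`.
  have hone (R : Measure Conf) {t : ENNReal} (ht : 1 < t) (ht' : t ≠ ⊤) :
      burningLaw Ξ R (Set.Iic t) = burningLaw Ξ R (Set.Iic 1) := by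
    rw [burningLaw_apply hΞ measurableSet_Iic, burningLaw_apply hΞ measurableSet_Iic]
    congr 1
    ext x
    refine ⟨fun h => ?_, fun h => le_trans h ht.le⟩
    rcases burningTime_eq_top_or hΞ (w := x.1) (F := x.2) (i := []) with h' | h'
    · exact absurd (top_le_iff.1 (h'.symm.le.trans h)) ht'
    · exact h'
  refine Measure.ext_of_Iic _ _ fun t => ?_
  rcases le_or_gt t 1 with ht | ht
  · exact key ht
  · rcases eq_or_ne t ⊤ with rfl | ht'
    · simp
    · rw [hone Q ht ht', hone Q' ht ht', key le_rfl]

end Uniqueness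

/-! ### Uniqueness of the joint law of marks and root burning time -/

section Endogeny

variable {Ξ : Set ℝ} {Q Q' : Measure Conf}

/-- Forget the marks of all words of length at least `n`. -/
def truncate (n : ℕ) (w : Word → Mark) : Word → Mark :=
  fun i => if i.length < n then w i else (0, 0)

/-- The marks of the tree whose root has mark `m` and whose children have the marks `w₀`, `w₁`
above them. -/
def glue (m : Mark) (w₀ w₁ : Word → Mark) : Word → Mark
  | [] => m
  | j :: i => if j = 0 then w₀ i else w₁ i

lemma truncate_succ (n : ℕ) (w : Word → Mark) :
    truncate (n + 1) w =
      glue (w []) (truncate n (shiftMarks [0] w)) (truncate n (shiftMarks [1] w)) := by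
  funext i
  cases i with
  | nil => simp [truncate, glue]
  | cons j i => fin_cases j <;> simp [truncate, glue, shiftMarks]

lemma measurable_truncate (n : ℕ) : Measurable (truncate n) := by
  refine measurable_pi_iff.2 fun i => ?_
  unfold truncate
  split_ifs <;> fun_prop

lemma measurable_glue : Measurable fun z : Mark × (Word → Mark) × (Word → Mark) =>
    glue z.1 z.2.1 z.2.2 := by
  refine measurable_pi_iff.2 fun i => ?_
  cases i with
  | nil => exact measurable_fst
  | cons j i => fin_cases j <;> simp only [glue] <;> simp <;> fun_prop

lemma measurable_burningMap : Measurable fun z : Mark × ENNReal × ENNReal =>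
    burningMap z.1 z.2.1 z.2.2 := by
  unfold burningMap
  refine Measurable.ite ?_ (Measurable.ite ?_ measurable_const (by fun_prop)) (by fun_prop)
  · exact (by fun_prop : Measurable fun z : Mark × ENNReal × ENNReal => z.1.2 = 0).setOf
  · exact measurableSet_le (by fun_prop) (by fun_prop)

/-- The truncated marks together with the burning time of the root. -/
noncomputable def truncatedPair (Ξ : Set ℝ) (n : ℕ) (x : Conf) : (Word → Mark) × ENNReal :=
  (truncate n x.1, rootTime Ξ x)

lemma measurable_truncatedPair (hΞ : IsRelClosed Ξ) (n : ℕ) : Measurable (truncatedPair Ξ n) :=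
  ((measurable_truncate n).comp measurable_fst).prodMk (measurable_rootTime hΞ)

/-- One step of the recursion for marks and burning times. -/
noncomputable def gluePair (z : Mark × ((Word → Mark) × ENNReal) × ((Word → Mark) × ENNReal)) :
    (Word → Mark) × ENNReal :=
  (glue z.1 z.2.1.1 z.2.2.1, burningMap z.1 z.2.1.2 z.2.2.2)

lemma measurable_gluePair : Measurable gluePair :=
  (measurable_glue.comp (by fun_prop : Measurable fun z : Mark × ((Word → Mark) × ENNReal) ×
    ((Word → Mark) × ENNReal) => (z.1, z.2.1.1, z.2.2.1))).prodMk
  (measurable_burningMap.comp (by fun_prop : Measurable fun z : Mark × ((Word → Mark) × ENNReal) ×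
    ((Word → Mark) × ENNReal) => (z.1, z.2.1.2, z.2.2.2)))

/-- The pair at depth `n + 1` is almost surely a function of the root mark and the children's pairs
at depth `n`, which are independent of each other and of that mark. -/
lemma IsRecursiveLaw.map_truncatedPair_succ [IsProbabilityMeasure Q] (hΞ : IsRelClosed Ξ)
    (hQ : IsRecursiveLaw Ξ Q) (n : ℕ) :
    Q.map (truncatedPair Ξ (n + 1)) = (markLaw.prod
      ((Q.map (truncatedPair Ξ n)).prod (Q.map (truncatedPair Ξ n)))).map gluePair := by
  have hV := measurable_truncatedPair hΞ n
  have h1 : truncatedPair Ξ (n + 1) =ᵐ[Q]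
      (gluePair ∘ Prod.map id (Prod.map (truncatedPair Ξ n) (truncatedPair Ξ n))) ∘ decompose := by
    filter_upwards [hQ.frozenEq, hQ.pos] with x hx h0
    refine Prod.ext ?_ (rootTime_eq_burningMap hΞ hx h0)
    exact truncate_succ n x.1
  rw [Measure.map_congr h1, ← Measure.map_map (measurable_gluePair.comp
    (measurable_id.prodMap (hV.prodMap hV))) measurable_decompose, hQ.map_decompose,
    ← Measure.map_map measurable_gluePair (measurable_id.prodMap (hV.prodMap hV)),
    ← Measure.map_prod_map _ _ measurable_id (hV.prodMap hV), ← Measure.map_prod_map _ _ hV hV,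
    Measure.map_id]

lemma IsRecursiveLaw.map_truncatedPair_eq [IsProbabilityMeasure Q] [IsProbabilityMeasure Q']
    (hΞ : IsRelClosed Ξ) (hQ : IsRecursiveLaw Ξ Q) (hQ' : IsRecursiveLaw Ξ Q') (n : ℕ) :
    Q.map (truncatedPair Ξ n) = Q'.map (truncatedPair Ξ n) := by
  induction n with
  | zero =>
    have h0 : truncatedPair Ξ 0 = (fun y : ENNReal => ((fun _ => (0, 0) : Word → Mark), y)) ∘
        rootTime Ξ := by
      funext x
      exact Prod.ext (by funext i; simp [truncatedPair, truncate]) rfl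
    have h := hQ.burningLaw_eq hΞ hQ'
    rw [burningLaw, burningLaw] at h
    rw [h0, ← Measure.map_map (by fun_prop) (measurable_rootTime hΞ), h,
      Measure.map_map (by fun_prop) (measurable_rootTime hΞ)]
  | succ n ih => rw [hQ.map_truncatedPair_succ hΞ, hQ'.map_truncatedPair_succ hΞ, ih]

lemma truncate_truncate {m n : ℕ} (h : m ≤ n) (w : Word → Mark) :
    truncate m (truncate n w) = truncate m w := by
  funext i
  by_cases hi : i.length < m
  · simp [truncate, hi, hi.trans_le h]
  · simp [truncate, hi]

/-- Events depending on the marks up to a finite depth and on the second coordinate form a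
generating π-system; `truncate_truncate` brings two of them to a common depth. -/
lemma ext_of_map_truncate {R R' : Measure ((Word → Mark) × ENNReal)} [IsProbabilityMeasure R]
    [IsProbabilityMeasure R']
    (h : ∀ n, R.map (Prod.map (truncate n) id) = R'.map (Prod.map (truncate n) id)) : R = R' := by
  let T (n : ℕ) : (Word → Mark) × ENNReal → (Word → Mark) × ENNReal := Prod.map (truncate n) id
  have hT (n : ℕ) : Measurable (T n) := (measurable_truncate n).prodMap measurable_id
  have hTT {m n : ℕ} (h : m ≤ n) : T m ∘ T n = T m := by
    funext z
    exact Prod.ext (truncate_truncate h z.1) rfl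
  let 𝒞 : Set (Set ((Word → Mark) × ENNReal)) := {s | ∃ n A, MeasurableSet A ∧ s = T n ⁻¹' A}
  refine ext_of_generate_finite 𝒞 (le_antisymm ?_ ?_) ?_ ?_ (by simp)
  · have h1 : Measurable[MeasurableSpace.generateFrom 𝒞]
        (Prod.fst : (Word → Mark) × ENNReal → Word → Mark) := by
      refine (@measurable_pi_iff _ _ _ (MeasurableSpace.generateFrom 𝒞) _ _).2 fun i => ?_
      intro B hB
      refine MeasurableSpace.measurableSet_generateFrom
        ⟨i.length + 1, (fun z => z.1 i) ⁻¹' B, ?_, ?_⟩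
      · exact (by fun_prop : Measurable fun z : (Word → Mark) × ENNReal => z.1 i) hB
      · ext z
        simp [T, truncate]
    have h2 : Measurable[MeasurableSpace.generateFrom 𝒞]
        (Prod.snd : (Word → Mark) × ENNReal → ENNReal) := by
      intro B hB
      exact MeasurableSpace.measurableSet_generateFrom ⟨0, Prod.snd ⁻¹' B, measurable_snd hB, rfl⟩
    exact sup_le h1.comap_le h2.comap_le
  · refine MeasurableSpace.generateFrom_le ?_
    rintro _ ⟨n, A, hA, rfl⟩
    exact hT n hA
  · rintro _ ⟨m, A, hA, rfl⟩ _ ⟨n, B, hB, rfl⟩ -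
    refine ⟨max m n, T m ⁻¹' A ∩ T n ⁻¹' B, (hT m hA).inter (hT n hB), ?_⟩
    rw [Set.preimage_inter, ← Set.preimage_comp, ← Set.preimage_comp, hTT (le_max_left _ _),
      hTT (le_max_right _ _)]
  · rintro _ ⟨n, A, hA, rfl⟩
    rw [← Measure.map_apply (hT n) hA, ← Measure.map_apply (hT n) hA, h n]

/-- The joint law of the marks and the burning time of the root is unique. -/
lemma IsRecursiveLaw.map_marks_rootTime_eq [IsProbabilityMeasure Q] [IsProbabilityMeasure Q']
    (hΞ : IsRelClosed Ξ) (hQ : IsRecursiveLaw Ξ Q) (hQ' : IsRecursiveLaw Ξ Q') :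
    Q.map (fun x => (x.1, rootTime Ξ x)) = Q'.map (fun x => (x.1, rootTime Ξ x)) := by
  have hU : Measurable fun x : Conf => (x.1, rootTime Ξ x) :=
    measurable_fst.prodMk (measurable_rootTime hΞ)
  have := Measure.isProbabilityMeasure_map (μ := Q) hU.aemeasurable
  have := Measure.isProbabilityMeasure_map (μ := Q') hU.aemeasurable
  refine ext_of_map_truncate fun n => ?_
  have hT := (measurable_truncate n).prodMap (measurable_id (α := ENNReal))
  rw [Measure.map_map hT hU, Measure.map_map hT hU]
  exact hQ.map_truncatedPair_eq hΞ hQ' n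

lemma IsRecursiveLaw.ae_rootTime_eq [IsProbabilityMeasure Q] [IsProbabilityMeasure Q']
    (hΞ : IsRelClosed Ξ) (hQ : IsRecursiveLaw Ξ Q) (hQ' : IsRecursiveLaw Ξ Q')
    {g : (Word → Mark) → ENNReal} (hg : Measurable g) (h : ∀ᵐ x ∂Q, rootTime Ξ x = g x.1) :
    ∀ᵐ x ∂Q', rootTime Ξ x = g x.1 := by
  have hU : Measurable fun x : Conf => (x.1, rootTime Ξ x) :=
    measurable_fst.prodMk (measurable_rootTime hΞ)
  have hs : MeasurableSet {z : (Word → Mark) × ENNReal | z.2 = g z.1} :=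
    measurableSet_eq_fun measurable_snd (hg.comp measurable_fst)
  have h1 := (ae_map_iff (μ := Q) hU.aemeasurable hs).2 h
  rw [hQ.map_marks_rootTime_eq hΞ hQ'] at h1
  exact (ae_map_iff hU.aemeasurable hs).1 h1

variable {S : Type u} [MeasurableSpace S] {P : Measure S} {ω : S → Word → Mark}
  {F F' : S → Set Word}

/-- The identity at the root is a statement about the law, and that law is invariant under the shift
to `j`. -/
lemma IsTreeSolution.ae_burningTime_eq [IsProbabilityMeasure P] (hΞ : IsRelClosed Ξ)
    [IsProbabilityMeasure Q] (hQ : IsRecursiveLaw Ξ Q)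
    {g : (Word → Mark) → ENNReal} (hg : Measurable g) (h : ∀ᵐ x ∂Q, rootTime Ξ x = g x.1)
    (hF : IsTreeSolution Ξ P ω F) :
    ∀ᵐ s ∂P, ∀ j, burningTime Ξ (ω s) (F s) j = g (shiftMarks j (ω s)) := by
  have hX : Measurable fun s => (ω s, F s) := hF.marks.measurable.prodMk hF.solution.measurable
  have := Measure.isProbabilityMeasure_map (μ := P) hX.aemeasurable
  have hF' := (isTreeSolution_map_iff hΞ hF.marks.measurable hF.solution.measurable).2 hF
  refine ae_all_iff.2 fun j => ?_
  have h1 := hQ.ae_rootTime_eq hΞ hF'.isRecursiveLaw hg h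
  rw [← map_shiftConf_eq hF' j] at h1
  have h2 := ae_of_ae_map hX.aemeasurable
    (ae_of_ae_map (f := shiftConf j) (measurable_shiftConf j).aemeasurable h1)
  filter_upwards [h2] with s hs
  rw [burningTime_eq_shift]
  exact hs

lemma ae_eq_of_endogenous [IsProbabilityMeasure P] (hΞ : IsRelClosed Ξ)
    [IsProbabilityMeasure Q] (hQ : IsRecursiveLaw Ξ Q)
    {g : (Word → Mark) → ENNReal} (hg : Measurable g) (h : ∀ᵐ x ∂Q, rootTime Ξ x = g x.1)
    (hF : IsTreeSolution Ξ P ω F) (hF' : IsTreeSolution Ξ P ω F') : ∀ᵐ s ∂P, F s = F' s := by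
  filter_upwards [hF.ae_burningTime_eq hΞ hQ hg h, hF'.ae_burningTime_eq hΞ hQ hg h,
    hF.solution.solves, hF'.solution.solves] with s h1 h2 h3 h4
  ext i
  rw [(frozenEq_iff hΞ).1 h3, (frozenEq_iff hΞ).1 h4, h1, h2]

end Endogeny

/-! ### Conditionally independent copies -/

section Coupling

/-- If the second coordinate is a.s. determined by the first in the sense that two conditionally
independent copies agree, then it is a.s. a measurable function of the first coordinate. -/
lemma exists_measurable_of_condIndep_eq {α : Type*} [MeasurableSpace α] {Q : Measure (α × Set Word)}
    [IsProbabilityMeasure Q]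
    (h : ∀ᵐ z ∂(Q.fst ⊗ₘ (Q.condKernel ×ₖ Q.condKernel)), z.2.1 = z.2.2) :
    ∃ g : α → Set Word, Measurable g ∧ ∀ᵐ x ∂Q, x.2 = g x.1 := by
  let κ := Q.condKernel
  let I (i : Word) : Set (Set Word) := {F | i ∈ F}
  have hI (i : Word) : MeasurableSet (I i) := measurableSet_mem i
  have h1 : ∀ᵐ a ∂Q.fst, ∀ i, κ a (I i) = 0 ∨ κ a (I i)ᶜ = 0 := by
    have h2 := Measure.ae_ae_of_ae_compProd h
    filter_upwards [h2] with a ha i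
    -- Otherwise the two samples would disagree about `i` with positive probability; so membership
    -- of `i` obeys a conditional 0–1 law.
    have h3 : (κ ×ₖ κ) a (I i ×ˢ (I i)ᶜ) = 0 := by
      refine measure_mono_null ?_ (ae_iff.1 ha)
      rintro ⟨A, B⟩ ⟨hA, hB⟩ heq
      exact hB ((Set.ext_iff.1 heq i).1 hA)
    rwa [Kernel.prod_apply, Measure.prod_prod, mul_eq_zero] at h3
  refine ⟨fun a => {i | κ a (I i) ≠ 0}, measurable_set_iff.2 fun i => ?_, ?_⟩
  · exact ((κ.measurable_coe (hI i)).eq_const 0).not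
  · have hset (i : Word) : MeasurableSet {x : α × Set Word | i ∈ x.2 ↔ κ x.1 (I i) ≠ 0} :=
      (((measurable_set_mem i).comp measurable_snd).iff
        (((κ.measurable_coe (hI i)).comp measurable_fst).eq_const 0).not).setOf
    have h4 : ∀ᵐ x ∂Q, ∀ i, i ∈ x.2 ↔ κ x.1 (I i) ≠ 0 := by
      refine ae_all_iff.2 fun i => ?_
      rw [← Q.disintegrate κ]
      refine (Measure.ae_compProd_iff (hset i)).2 ?_
      filter_upwards [h1] with a ha
      rcases ha i with h0 | h0
      · rw [ae_iff]
        refine measure_mono_null ?_ h0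
        intro A hA
        by_contra hc
        exact hA ⟨fun hi => absurd hi hc, fun hi => absurd h0 hi⟩
      · have h5 : κ a (I i) ≠ 0 := by
          intro h6
          have := measure_add_measure_compl (μ := κ a) (hI i)
          rw [h0, h6] at this
          simp at this
        rw [ae_iff]
        refine measure_mono_null ?_ h0
        intro A hA hc
        exact hA ⟨fun _ => h5, fun _ => hc⟩
    filter_upwards [h4] with x hx
    ext i
    exact hx i

lemma map_condIndep_fst {α : Type*} [MeasurableSpace α] {Q : Measure (α × Set Word)}
    [IsProbabilityMeasure Q] :
    (Q.fst ⊗ₘ (Q.condKernel ×ₖ Q.condKernel)).map (fun z => (z.1, z.2.1)) = Q := by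
  have := Measure.compProd_map (μ := Q.fst) (κ := Q.condKernel ×ₖ Q.condKernel)
    (f := Prod.fst) measurable_fst
  rw [← Kernel.fst_eq, Kernel.fst_prod, Q.disintegrate] at this
  exact this.symm

lemma map_condIndep_snd {α : Type*} [MeasurableSpace α] {Q : Measure (α × Set Word)}
    [IsProbabilityMeasure Q] :
    (Q.fst ⊗ₘ (Q.condKernel ×ₖ Q.condKernel)).map (fun z => (z.1, z.2.2)) = Q := by
  have := Measure.compProd_map (μ := Q.fst) (κ := Q.condKernel ×ₖ Q.condKernel)
    (f := Prod.snd) measurable_snd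
  rw [← Kernel.snd_eq, Kernel.snd_prod, Q.disintegrate] at this
  exact this.symm

end Coupling

end FrozenPercolation

/-! ### The equivalence -/

open FrozenPercolation in
theorem lemma7
    (Ξ : Set ℝ) (hΞ : Ξ ⊆ Set.Ioc (0 : ℝ) 1)
    (hΞ_closed : ∃ C : Set ℝ, IsClosed C ∧ Ξ = C ∩ Set.Ioc (0 : ℝ) 1)
    (S : Type u) [MeasurableSpace S] (P : Measure S) [IsProbabilityMeasure P]
    (ω : S → Word → Mark) (hω : IsMarkField P ω)
    (F : S → Set Word) (hF : IsFrozenSolution Ξ P ω F)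
    (hF_stat : IsStationary P ω F) (hF_adapted : IsAdapted P ω F)
    (hF_tree : RespectsTree P ω F) :
    IsEndogenous Ξ P ω F ↔
      ∀ (S' : Type v) [MeasurableSpace S'] (P' : Measure S') [IsProbabilityMeasure P']
        (ω' : S' → Word → Mark) (F₁ F₂ : S' → Set Word),
        IsMarkField P' ω' →
        IsFrozenSolution Ξ P' ω' F₁ → IsStationary P' ω' F₁ →
        IsAdapted P' ω' F₁ → RespectsTree P' ω' F₁ →
        IsFrozenSolution Ξ P' ω' F₂ → IsStationary P' ω' F₂ →
        IsAdapted P' ω' F₂ → RespectsTree P' ω' F₂ →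
        ∀ᵐ s ∂P', F₁ s = F₂ s := by
  have hΞ' : IsRelClosed Ξ := ⟨hΞ, hΞ_closed⟩
  have hT : IsTreeSolution Ξ P ω F := ⟨hω, hF, hF_stat, hF_adapted, hF_tree⟩
  have hX : Measurable fun s => (ω s, F s) := hω.measurable.prodMk hF.measurable
  obtain ⟨Q, hQ⟩ : ∃ Q, Q = P.map fun s => (ω s, F s) := ⟨_, rfl⟩
  have hQprob : IsProbabilityMeasure Q := hQ ▸ Measure.isProbabilityMeasure_map hX.aemeasurable
  have hQT : IsTreeSolution Ξ Q Prod.fst Prod.snd :=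
    hQ ▸ (isTreeSolution_map_iff hΞ' hω.measurable hF.measurable).2 hT
  constructor
  · rintro ⟨Y, hY, hYF⟩ S' _ P' _ ω' F₁ F₂ hω' h1 h2 h3 h4 h5 h6 h7 h8
    -- Doob–Dynkin factorization through the marks.
    obtain ⟨g, hg, rfl⟩ := hY.exists_eq_measurable_comp
    have hgQ : ∀ᵐ x ∂Q, rootTime Ξ x = g x.1 := by
      rw [hQ]
      exact (ae_map_iff hX.aemeasurable (measurableSet_eq_fun (measurable_rootTime hΞ')
        (hg.comp measurable_fst))).2 hYF
    exact ae_eq_of_endogenous hΞ' hQT.isRecursiveLaw hg hgQ ⟨hω', h1, h2, h3, h4⟩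
      ⟨hω', h5, h6, h7, h8⟩
  · intro h
    let R := Q.fst ⊗ₘ (Q.condKernel ×ₖ Q.condKernel)
    -- The coupling is lifted because the uniqueness hypothesis quantifies over `Type v`.
    let P' : Measure (ULift.{v} ((Word → Mark) × Set Word × Set Word)) := R.map ULift.up
    have hup : Measurable (ULift.up.{v} : (Word → Mark) × Set Word × Set Word → _) := measurable_up
    have hP' : IsProbabilityMeasure P' := Measure.isProbabilityMeasure_map hup.aemeasurable
    have hd : Measurable (ULift.down.{v} : _ → (Word → Mark) × Set Word × Set Word) := measurable_down
    have m0 := measurable_fst.comp hd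
    have m1 := (measurable_fst.comp measurable_snd).comp hd
    have m2 := (measurable_snd.comp measurable_snd).comp hd
    -- The marks paired with either copy again have joint law `Q`.
    have s1 := (isTreeSolution_map_iff (P := P') hΞ' m0 m1).1 (by
      rw [Measure.map_map (m0.prodMk m1) hup]
      exact (map_condIndep_fst (Q := Q)).symm ▸ hQT)
    have s2 := (isTreeSolution_map_iff (P := P') hΞ' m0 m2).1 (by
      rw [Measure.map_map (m0.prodMk m2) hup]
      exact (map_condIndep_snd (Q := Q)).symm ▸ hQT)
    have h' := h _ P' _ _ _ s1.1 s1.2 s1.3 s1.4 s1.5 s2.2 s2.3 s2.4 s2.5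
    obtain ⟨g, hg, hgQ⟩ := exists_measurable_of_condIndep_eq (Q := Q)
      (ae_of_ae_map hup.aemeasurable h')
    rw [hQ] at hgQ
    refine ⟨(fun w => burningTime Ξ w (g w) []) ∘ ω, ?_, ?_⟩
    · exact ((measurable_rootTime hΞ').comp (measurable_id.prodMk hg)).comp
        (comap_measurable ω)
    · filter_upwards [ae_of_ae_map hX.aemeasurable hgQ] with s hs
      have hs' : F s = g (ω s) := hs
      simp only [Function.comp_apply, hs']
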